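/- **Setting.** Consider $N$ agents $\mathcal V=\{1,\dots,N\}$ with a time-varying undirected topology $\mathcal G(k)=(\mathcal V,\mathcal E(k))$, $k\ge 0$, without self-loops. At each time $k$ some agents may suffer from node failure; a failed agent has no edge in $\mathcal G(k)$. On a probability space let the following random variables, over all $i,j\in\mathcal V$ and $k\ge0$, be mutually independent: $\gamma_i(k)\in\{0,1\}$ with $\mathbb P(\gamma_i(k)=1)=p_i\in(0,1)$ (the choice of one of two time slots for transmission); the fading channels $h_{ij}(k)\sim\mathcal{CN}(0,\Lambda_{ij})$, where $\Lambda_{ij}=\Lambda_{ji}$, and $\Lambda_{ij}>0$ if $(i,j)\in\mathcal E(k)$ for some $k$; and the noises $n_i(k)\sim\mathcal{CN}(0,\sigma_i^2)$. Here $\mathcal{CN}(0,v)$ is the law of a complex random variable whose real and imaginary parts are independent $N(0,v/2)$. Let $\rho>0$, let $u\in\mathbb C$ with $|u|=1$, let $\alpha(k)>0$ be step sizes, and let $x_i(0)\ge 0$ be deterministic initial states. Put $$\Gamma_{ij}(k)=\gamma_i(k)(1-\gamma_j(k))+\gamma_j(k)(1-\gamma_i(k)),\qquad \bar a_{ij}(k)=\begin{cases}\rho\,(p_i(1-p_j)+p_j(1-p_i))\,\Lambda_{ij},&(i,j)\in\mathcal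 E(k),\\0,&(i,j)\notin\mathcal E(k).\end{cases}$$ Agent $i$ receives $$y_i(k)=\sum_{j:(i,j)\in\mathcal E(k)}\Gamma_{ij}(k)\,h_{ij}(k)\sqrt{\rho x_j(k)}\,u+n_i(k),$$ where $\sqrt{\cdot}$ is the principal complex square root (so $\sqrt{\rho x}=i\sqrt{\rho|x|}$ if $x<0$), and the protocol is $$x_i(k+1)=\Big(1-\alpha(k)\sum_{j\in\mathcal V}\bar a_{ij}(k)\Big)x_i(k)+\alpha(k)\big(|y_i(k)|^2-\sigma_i^2\big)$$ if agent $i$ has not failed at time $k$, and $x_i(k+1)=x_i(k)$ if it has. **Theorem.** Assume that 1. $\sum_{k}\alpha(k)=\infty$, $\sum_k\alpha(k)^2<\infty$, and $1-\alpha(k)\sum_{j\in\mathcal V}\bar a_{ij}(k)>0$ for all $i\in\mathcal V$, $k\ge0$; 2. there is an integer $L>0$ such that for every $k\ge 0$ the joint graph $\mathcal G(k)\cup\mathcal G(k+1)\cup\dots\cup\mathcal G(k+L-1)$ is connected; 3. $\alpha(k+1)\le\alpha(k)$ for all $k\ge0$, and $\limsup_{k\to\infty}\alpha(k)/\alpha(k+1)<\infty$.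 Then the system achieves almost sure consensus: there is a real random variable $x^*$ such that for every $i\in\mathcal V$, $\lim_{k\to\infty}x_i(k)=x^*$ almost surely. -/

import Mathlib

open MeasureTheory ProbabilityTheory Filter Topology
open scoped NNReal

namespace OverTheAir

/-- The circularly symmetric complex Gaussian law `CN(0, v)`: the real and the imaginary part are
independent real Gaussians with mean `0` and variance `v / 2` (a Dirac mass at `0` if `v = 0`). -/
noncomputable def complexGaussian (v : ℝ≥0) : Measure ℂ :=
  ((gaussianReal 0 (v / 2)).prod (gaussianReal 0 (v / 2))).map
    (fun z : ℝ × ℝ => (⟨z.1, z.2⟩ : ℂ))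

/-- The deterministic parameters of the multi-agent system with `N` agents, a time-varying
undirected topology and half-duplex non-coherent over-the-air aggregation. -/
structure System (N : ℕ) where
  /-- `p i` is the probability that agent `i` transmits in the first slot -/
  p : Fin N → ℝ
  p_mem : ∀ i, p i ∈ Set.Ioo (0 : ℝ) 1
  /-- the time-varying undirected network topology `G(k)` -/
  G : ℕ → SimpleGraph (Fin N)
  /-- the agents that suffer from node failure at time `k` -/
  failed : ℕ → Set (Fin N)
  /-- a failed agent cannot communicate with any other agent -/
  not_adj_of_failed : ∀ k, ∀ i ∈ failed k, ∀ j, ¬ (G k).Adj i j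
  /-- `Λ i j` is the variance of the fading channel from agent `j` to agent `i` -/
  Λ : Fin N → Fin N → ℝ≥0
  Λ_symm : ∀ i j, Λ i j = Λ j i
  Λ_pos : ∀ k i j, (G k).Adj i j → 0 < Λ i j
  /-- `σ i ^ 2` is the variance of the receiver noise of agent `i` -/
  σ : Fin N → ℝ≥0
  /-- the transmission coefficient for power control -/
  ρ : ℝ
  ρ_pos : 0 < ρ
  /-- the carrier wave -/
  u : ℂ
  norm_u : ‖u‖ = 1
  /-- the step sizes -/
  α : ℕ → ℝ
  α_pos : ∀ k, 0 < α k
  /-- the initial information states -/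
  x₀ : Fin N → ℝ
  x₀_nonneg : ∀ i, 0 ≤ x₀ i

namespace System

variable {N : ℕ} (S : System N)

open Classical in
/-- The mean weight `ā_ij(k) = ρ (p_i (1 - p_j) + p_j (1 - p_i)) Λ_ij` if `(i, j)` is an edge of
`G(k)`, and `0` otherwise. -/
noncomputable def abar (k : ℕ) (i j : Fin N) : ℝ :=
  if (S.G k).Adj i j then
    S.ρ * (S.p i * (1 - S.p j) + S.p j * (1 - S.p i)) * (S.Λ i j : ℝ)
  else 0

/-- Step size conditions: `∑ α(k) = ∞`, `∑ α(k)² < ∞`, and `1 - α(k) ∑_j ā_ij(k) > 0`. -/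
structure StepSize : Prop where
  sum_eq_top : Tendsto (fun n => ∑ k ∈ Finset.range n, S.α k) atTop atTop
  summable_sq : Summable (fun k => S.α k ^ 2)
  weight_pos : ∀ i k, 0 < 1 - S.α k * ∑ j, S.abar k i j

/-- `L`-connectivity: for some `L > 0`, every joint graph
`G(k) ∪ G(k+1) ∪ ⋯ ∪ G(k+L-1)` is connected. -/
def JointlyConnected : Prop :=
  ∃ L : ℕ, 0 < L ∧ ∀ k : ℕ, (⨆ t ∈ Finset.Ico k (k + L), S.G t).Connected

/-- Regularity of the step sizes: `α` is nonincreasing and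
`limsup α(k) / α(k+1) < ∞`. -/
structure StepSizeRegular : Prop where
  le_succ : ∀ k, S.α (k + 1) ≤ S.α k
  limsup_lt_top : IsBoundedUnder (· ≤ ·) atTop (fun k => S.α k / S.α (k + 1))

/-- The signal `√(ρ x) u` sent by an agent in state `x`. The square root is the complex principal
one: the usual root for `x ≥ 0`, and `i √(ρ |x|)` for `x < 0`, so the sent power is `ρ |x|`. -/
noncomputable def signal (x : ℝ) : ℂ :=
  Complex.sqrt ((S.ρ * x : ℝ) : ℂ) * S.u

end System

/-- The random inputs of the system on the probability space `(Ω, μ)`: the slot choices `γ`, the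
fading channels `h` and the receiver noises `n`, all mutually independent. -/
structure Inputs {N : ℕ} (S : System N) {Ω : Type*} [MeasurableSpace Ω] (μ : Measure Ω) where
  /-- `γ k i` is `1` if agent `i` transmits in the first slot at time `k`, and `0` if it transmits
  in the second one -/
  γ : ℕ → Fin N → Ω → ℝ
  /-- `h k i j` is the channel from the transmit antenna of `j` to the receive antenna of `i` -/
  h : ℕ → Fin N → Fin N → Ω → ℂ
  /-- `n k i` is the receiver noise of agent `i` at time `k` -/
  n : ℕ → Fin N → Ω → ℂ
  measurable_γ : ∀ k i, Measurable (γ k i)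
  measurable_h : ∀ k i j, Measurable (h k i j)
  measurable_n : ∀ k i, Measurable (n k i)
  γ_zero_or_one : ∀ k i ω, γ k i ω = 0 ∨ γ k i ω = 1
  γ_law : ∀ k i, μ {ω | γ k i ω = 1} = ENNReal.ofReal (S.p i)
  h_law : ∀ k i j, HasLaw (h k i j) (complexGaussian (S.Λ i j)) μ
  n_law : ∀ k i, HasLaw (n k i) (complexGaussian (S.σ i ^ 2)) μ
  /-- joint mutual independence of the whole family (`γ` is read as complex-valued) -/
  indep : iIndepFun
    (Sum.elim (fun (s : ℕ × Fin N) (ω : Ω) => (γ s.1 s.2 ω : ℂ))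
      (Sum.elim (fun (s : ℕ × Fin N × Fin N) (ω : Ω) => h s.1 s.2.1 s.2.2 ω)
        (fun (s : ℕ × Fin N) (ω : Ω) => n s.1 s.2 ω))) μ

namespace Inputs

variable {N : ℕ} {S : System N} {Ω : Type*} [MeasurableSpace Ω] {μ : Measure Ω}
  (I : Inputs S μ)

/-- `Γ_ij(k) = γ_i(k) (1 - γ_j(k)) + γ_j(k) (1 - γ_i(k))`, which is `1` if `i` and `j` choose
different slots at time `k`, and `0` otherwise. -/
def Γ (k : ℕ) (i j : Fin N) (ω : Ω) : ℝ :=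
  I.γ k i ω * (1 - I.γ k j ω) + I.γ k j ω * (1 - I.γ k i ω)

open Classical in
/-- The signal `y_i(k) = ∑_{j ∈ Ñ_i(k)} Γ_ij(k) h_ij(k) s_j(k) + n_i(k)` received by agent `i` at
time `k`, when the agents are in the states `x`; here `Ñ_i(k)` is the set of the neighbours of `i`
in `G(k)`. -/
noncomputable def received (k : ℕ) (x : Fin N → ℝ) (i : Fin N) (ω : Ω) : ℂ :=
  (∑ j with (S.G k).Adj i j, (I.Γ k i j ω : ℂ) * I.h k i j ω * S.signal (x j)) + I.n k i ω

open Classical in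
/-- The information states `x_i(k)` under the consensus protocol
`x_i(k+1) = (1 - α(k) ∑_j ā_ij(k)) x_i(k) + α(k) (|y_i(k)|² - σ_i²)`;
an agent that suffers from node failure at time `k` keeps its state. -/
noncomputable def state : ℕ → Ω → Fin N → ℝ
  | 0, _ => S.x₀
  | k + 1, ω => fun i =>
      if i ∈ S.failed k then state k ω i
      else (1 - S.α k * ∑ j, S.abar k i j) * state k ω i
        + S.α k * (‖I.received k (state k ω) i ω‖ ^ 2 - (S.σ i : ℝ) ^ 2)

/-- Almost sure consensus: there is a random variable `x*` such that `x_i(k) → x*` almost surely,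
for every agent `i`. -/
def AlmostSureConsensus : Prop :=
  ∃ xstar : Ω → ℝ, Measurable xstar ∧
    ∀ i : Fin N, ∀ᵐ ω ∂μ, Tendsto (fun k => I.state k ω i) atTop (𝓝 (xstar ω))

end Inputs

end OverTheAir

namespace OverTheAir

/-! ### Deterministic consensus under convergent perturbations -/

/-! The channels and noises are centred and independent, so given the past the mean of `‖y_i(k)‖ ^
2` is `σ_i ^ 2 + ∑ j, ā_ij(k) |x_j(k)|`. The protocol is therefore `x(k+1) = x(k) - α(k) 𝓛(k) x(k) +
drift + α(k) ξ(k)`, where `𝓛(k)` is the Laplacian of the symmetric weights `ā(k)`, `ξ` is a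
martingale difference, and the drift `α(k) ∑ j, ā_ij(k) (|x_j| - x_j) ≥ 0` arises because power does
not reveal the sign of a state.

Both perturbations have almost surely convergent series. The mean step averages the values `x_i`,
`|x_j|` with symmetric weights, so it does not increase the sum of squares; the noise adds at most a
multiple of `α(k)² (1 + energy)`, and `∑ α² < ∞` bounds the energy (`exists_energy_le`). Hence `∑ α
ξ` is an `L²`-bounded martingale and converges (`ae_tendsto_noiseSum`). The Laplacian and the noise
do not change the expected sum of the states, which stays bounded; so the expected drifts have a
finite sum and the nonnegative drifts are summable (`ae_summable_signDrift`).

The rest is pathwise and deterministic (`exists_tendsto_of_jointlyConnected`). Adding to `x` the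
tails of the perturbation series turns the perturbation into `α(k)` times a null sequence. The
average is then conserved. The deviation from it contracts over a window of `L` steps by a factor `1
- c α(s)`, by a Poincaré inequality on the joint graph (`sum_sq_le_of_connected`); comparability of
the step sizes in a window makes `α(s)` the right scale, and `∑ α = ∞` drives the deviation to zero
(`tendsto_zero_of_persistent_excitation`). -/

lemma tendsto_zero_of_le_one_sub_mul_add {v a ε : ℕ → ℝ} (hv : ∀ m, 0 ≤ v m)
    (ha : ∀ᶠ m in atTop, a m ∈ Set.Icc (0 : ℝ) 1)
    (hsum : Tendsto (fun n => ∑ m ∈ Finset.range n, a m) atTop atTop)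
    (hε : Tendsto ε atTop (𝓝 0))
    (hrec : ∀ᶠ m in atTop, v (m + 1) ≤ (1 - a m) * v m + a m * ε m) :
    Tendsto v atTop (𝓝 0) := by
  rw [Metric.tendsto_atTop']
  intro δ hδ
  have hε' : ∀ᶠ m in atTop, ε m < δ / 2 := hε.eventually_lt_const (half_pos hδ)
  obtain ⟨m₀, hm₀⟩ := eventually_atTop.1 (ha.and (hε'.and hrec))
  -- Once `ε m < δ / 2`, the excess of `v` over `δ / 2` satisfies the recursion without forcing, so
  -- it decays like `exp (-∑ a)`.
  set w : ℕ → ℝ := fun m => max (v m - δ / 2) 0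
  set A : ℕ → ℝ := fun n => ∑ m ∈ Finset.range n, a m with hA
  have hw : ∀ m ≥ m₀, w (m + 1) ≤ Real.exp (-a m) * w m := by
    intro m hm
    obtain ⟨⟨h0, h1⟩, h2, h3⟩ := hm₀ m hm
    have h4 : 1 - a m ≤ Real.exp (-a m) := by
      have := Real.add_one_le_exp (-a m); linarith
    have h5 : w (m + 1) ≤ (1 - a m) * w m := by
      refine max_le ?_ (mul_nonneg (by linarith) (le_max_right _ _))
      have : (1 - a m) * (v m - δ / 2) ≤ (1 - a m) * w m :=
        mul_le_mul_of_nonneg_left (le_max_left _ _) (by linarith)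
      nlinarith [mul_le_mul_of_nonneg_left h2.le h0]
    exact h5.trans (mul_le_mul_of_nonneg_right h4 (le_max_right _ _))
  have hw' : ∀ m ≥ m₀, w m ≤ w m₀ * Real.exp (A m₀ - A m) := by
    intro m hm
    induction m, hm using Nat.le_induction with
    | base => simp
    | succ m hm ih =>
      refine (hw m hm).trans ((mul_le_mul_of_nonneg_left ih (Real.exp_pos _).le).trans_eq ?_)
      have : A (m + 1) = A m + a m := Finset.sum_range_succ _ _
      rw [this, mul_left_comm, ← Real.exp_add]
      ring_nf
  have hlim : Tendsto (fun m => w m₀ * Real.exp (A m₀ - A m)) atTop (𝓝 0) := by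
    have : Tendsto (fun m => A m₀ - A m) atTop atBot :=
      tendsto_atBot_add_const_left _ _ (tendsto_neg_atTop_atBot.comp hsum)
    simpa using (Real.tendsto_exp_atBot.comp this).const_mul (w m₀)
  obtain ⟨m₁, hm₁⟩ := eventually_atTop.1 (hlim.eventually_lt_const (half_pos hδ))
  refine ⟨max m₀ m₁, fun m hm => ?_⟩
  have h1 := hw' m (le_of_max_le_left hm.le)
  have h2 := hm₁ m (le_of_max_le_right hm.le)
  have h3 : v m - δ / 2 ≤ w m := le_max_left _ _
  rw [Real.dist_eq, sub_zero, abs_of_nonneg (hv m)]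
  linarith

/-- As `α` is nonincreasing, each block of `L` terms sums to at most `L` times its first term. -/
lemma tendsto_sum_mul_atTop {α : ℕ → ℝ} (hanti : Antitone α) {L : ℕ} (hL : 0 < L)
    (hsum : Tendsto (fun n => ∑ k ∈ Finset.range n, α k) atTop atTop) :
    Tendsto (fun n => ∑ m ∈ Finset.range n, α (m * L)) atTop atTop := by
  have key : ∀ n, ∑ k ∈ Finset.range (n * L), α k ≤ L * ∑ m ∈ Finset.range n, α (m * L) := by
    intro n
    induction n with
    | zero => simp
    | succ n ih =>
      rw [Nat.succ_mul, Finset.sum_range_add, Finset.sum_range_succ, mul_add]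
      refine add_le_add ih ?_
      calc ∑ x ∈ Finset.range L, α (n * L + x) ≤ ∑ _x ∈ Finset.range L, α (n * L) :=
            Finset.sum_le_sum fun x _ => hanti (Nat.le_add_right _ _)
        _ = L * α (n * L) := by simp
  have h1 : Tendsto (fun n => ∑ k ∈ Finset.range (n * L), α k) atTop atTop :=
    hsum.comp (tendsto_id.atTop_mul_const' hL)
  have hL' : (0 : ℝ) < L := by exact_mod_cast hL
  exact (tendsto_const_mul_atTop_of_pos hL').1 (tendsto_atTop_mono key h1)

/-! ### Contraction over a window of `L` steps -/

section Window

variable {E : Type*} [NormedAddCommGroup E] [InnerProductSpace ℝ E]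
  {z e : ℕ → E} {A : ℕ → E →ₗ[ℝ] E} {α : ℕ → ℝ} {K c : ℝ}

/-- Inside a window the state moves only by `O(α s)`, so it may be frozen at its initial value with
an error of second order. -/
lemma norm_sub_le_of_linear_step (hK : 0 ≤ K) (hAK : ∀ k v, ‖A k v‖ ≤ K * ‖v‖)
    (hα : ∀ k, 0 < α k) (hanti : Antitone α)
    (hz : ∀ k, z (k + 1) = z k - α k • A k (z k) + α k • e k)
    {s L : ℕ} (hs : K * L * α s ≤ 1 / 2) {ε : ℝ} (hε : ∀ j < L, ‖e (s + j)‖ ≤ ε)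
    (hε0 : 0 ≤ ε) :
    ∀ j ≤ L, ‖z (s + j) - z s‖ ≤ j * (α s * (2 * (K + 1)) * (‖z s‖ + ε)) := by
  intro j
  induction j with
  | zero => simp
  | succ j ih =>
    intro hj
    have ih := ih (by omega)
    set a := α s
    have ha : 0 < a := hα s
    set P := ‖z s‖ + ε with hP
    have hP0 : 0 ≤ P := by positivity
    have hjL : (j : ℝ) ≤ L := by exact_mod_cast (by omega : j ≤ L)
    have haj : α (s + j) ≤ a := hanti (Nat.le_add_right _ _)
    have hej := hε j (by omega)
    have hzj : ‖z (s + j)‖ ≤ ‖z s‖ + ‖z (s + j) - z s‖ := by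
      have := norm_add_le (z s) (z (s + j) - z s)
      simpa using this
    have hstep : z (s + (j + 1)) - z s =
        (z (s + j) - z s) + α (s + j) • (e (s + j) - A (s + j) (z (s + j))) := by
      rw [← add_assoc, hz, smul_sub]; abel
    have h1 : ‖e (s + j) - A (s + j) (z (s + j))‖ ≤ 2 * (K + 1) * P := by
      refine (norm_sub_le _ _).trans ?_
      have h2 := hAK (s + j) (z (s + j))
      have h3 : K * ‖z (s + j)‖ ≤ K * (‖z s‖ + j * (a * (2 * (K + 1)) * P)) :=
        mul_le_mul_of_nonneg_left (hzj.trans (by linarith)) hK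
      -- The displacement so far contributes at most `(K + 1) * P`, as much as the bound for the
      -- frozen state and `ε`; this is the factor `2` in the claim.
      have h4 : K * j * a ≤ 1 / 2 := le_trans (by gcongr) hs
      have h5 : K * (j * (a * (2 * (K + 1)) * P)) ≤ (K + 1) * P := by
        have : K * j * a * (2 * (K + 1) * P) ≤ 1 / 2 * (2 * (K + 1) * P) := by gcongr
        linarith
      have h6 : K * ‖z s‖ + ε ≤ (K + 1) * P := by
        have := norm_nonneg (z s); have := mul_nonneg hK hε0
        rw [hP]; nlinarith
      linarith
    rw [hstep]
    refine (norm_add_le _ _).trans ?_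
    rw [norm_smul, Real.norm_of_nonneg (hα _).le]
    have h7 : α (s + j) * ‖e (s + j) - A (s + j) (z (s + j))‖ ≤ a * (2 * (K + 1) * P) := by
      gcongr
    push_cast
    linarith

/-- The first group is the window with the state frozen at `z s`; the second collects the
perturbation and the error of freezing. -/
lemma add_window_eq (hz : ∀ k, z (k + 1) = z k - α k • A k (z k) + α k • e k) (s L : ℕ) :
    z (s + L) = (z s - ∑ j ∈ Finset.range L, α (s + j) • A (s + j) (z s))
      + ∑ j ∈ Finset.range L, α (s + j) • (e (s + j) - A (s + j) (z (s + j) - z s)) := by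
  induction L with
  | zero => simp
  | succ L ih =>
    rw [← add_assoc, hz, Finset.sum_range_succ, Finset.sum_range_succ]
    simp only [map_sub, smul_sub] at ih ⊢
    nth_rewrite 1 [ih]
    abel

/-- Write `a = α s` and let `T` be the frozen total step. Then `‖z s - T‖² = ‖z s‖² - 2⟪z s, T⟫ +
‖T‖² ≤ (1 - 2ca + ca) ‖z s‖²`, which gives the factor `1 - c a / 2`. The freezing error, of order
`a²`, uses up half of this gain and leaves `c / 4`. -/
lemma norm_window_le (hK : 0 ≤ K) (hAK : ∀ k v, ‖A k v‖ ≤ K * ‖v‖)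
    (hα : ∀ k, 0 < α k) (hanti : Antitone α)
    (hz : ∀ k, z (k + 1) = z k - α k • A k (z k) + α k • e k)
    {s L : ℕ} (hs : K * L * α s ≤ 1 / 2) {ε : ℝ} (hε : ∀ j < L, ‖e (s + j)‖ ≤ ε)
    (hε0 : 0 ≤ ε)
    (hcoer : c * α s * ‖z s‖ ^ 2 ≤ ∑ j ∈ Finset.range L, α (s + j) * inner ℝ (z s) (A (s + j) (z s)))
    (hs1 : c * α s ≤ 1) (hs2 : α s * (L * K) ^ 2 ≤ c)
    (hs3 : α s * (L ^ 2 * K * (2 * (K + 1))) ≤ c / 4)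
    (hs4 : α s * (L ^ 2 * K * (2 * (K + 1))) ≤ 1) :
    ‖z (s + L)‖ ≤ (1 - c / 4 * α s) * ‖z s‖ + α s * ((1 + L) * ε) := by
  set a := α s with ha_def
  have ha : 0 < a := hα s
  set T := ∑ j ∈ Finset.range L, α (s + j) • A (s + j) (z s)
  have haj : ∀ j, α (s + j) ≤ a := fun j => hanti (Nat.le_add_right _ _)
  have hT : ‖T‖ ≤ a * (L * K) * ‖z s‖ := by
    calc ‖T‖ ≤ ∑ j ∈ Finset.range L, a * (K * ‖z s‖) := by
          refine norm_sum_le_of_le _ fun j _ => ?_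
          rw [norm_smul, Real.norm_of_nonneg (hα _).le]
          gcongr
          · exact haj j
          · exact hAK _ _
      _ = _ := by simp; ring
  have hin : c * a * ‖z s‖ ^ 2 ≤ inner ℝ (z s) T := by
    simpa only [T, inner_sum, inner_smul_right] using hcoer
  have hT2 : ‖T‖ ^ 2 ≤ c * a * ‖z s‖ ^ 2 := by
    calc ‖T‖ ^ 2 ≤ (a * (L * K) * ‖z s‖) ^ 2 := by gcongr
      _ = a * (L * K) ^ 2 * (a * ‖z s‖ ^ 2) := by ring
      _ ≤ c * (a * ‖z s‖ ^ 2) := by gcongr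
      _ = _ := by ring
  have h1 : ‖z s - T‖ ≤ (1 - c / 2 * a) * ‖z s‖ := by
    refine abs_le_of_sq_le_sq' ?_ (mul_nonneg (by linarith) (norm_nonneg _)) |>.2
    rw [norm_sub_sq_real]
    nlinarith [sq_nonneg (c * a * ‖z s‖)]
  have h2 : ‖∑ j ∈ Finset.range L, α (s + j) • (e (s + j) - A (s + j) (z (s + j) - z s))‖
      ≤ L * (a * (ε + K * (L * (a * (2 * (K + 1)) * (‖z s‖ + ε))))) := by
    calc _ ≤ ∑ j ∈ Finset.range L, a * (ε + K * (L * (a * (2 * (K + 1)) * (‖z s‖ + ε)))) := by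
          refine norm_sum_le_of_le _ fun j hj => ?_
          have hj := Finset.mem_range.1 hj
          have hjL : (j : ℝ) ≤ L := by exact_mod_cast hj.le
          rw [norm_smul, Real.norm_of_nonneg (hα _).le]
          have h3 := norm_sub_le_of_linear_step hK hAK hα hanti hz hs hε hε0 j hj.le
          have h4 : ‖z (s + j) - z s‖ ≤ L * (a * (2 * (K + 1)) * (‖z s‖ + ε)) :=
            h3.trans (by gcongr)
          refine mul_le_mul (haj j) ?_ (norm_nonneg _) ha.le
          refine (norm_sub_le _ _).trans (add_le_add (hε j hj) ((hAK _ _).trans ?_))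
          gcongr
      _ = _ := by simp
  rw [add_window_eq hz s L]
  refine (norm_add_le _ _).trans ?_
  have h5 : a * (a * (L ^ 2 * K * (2 * (K + 1)))) * ‖z s‖ ≤ a * (c / 4) * ‖z s‖ := by gcongr
  have h6 : a * (a * (L ^ 2 * K * (2 * (K + 1)))) * ε ≤ a * 1 * ε := by gcongr
  nlinarith

lemma le_pow_mul_of_ratio_le {B : ℝ} (hB : 1 ≤ B) (hα : ∀ k, 0 < α k) {k₀ : ℕ}
    (hratio : ∀ k ≥ k₀, α k ≤ B * α (k + 1)) {s : ℕ} (hs : k₀ ≤ s) {L : ℕ} :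
    ∀ j ≤ L, α s ≤ B ^ L * α (s + j) := by
  have h : ∀ j, α s ≤ B ^ j * α (s + j) := by
    intro j
    induction j with
    | zero => simp
    | succ j ih =>
      refine ih.trans ?_
      rw [pow_succ, mul_assoc]
      exact mul_le_mul_of_nonneg_left (hratio _ (by omega)) (by positivity)
  intro j hj
  refine (h j).trans ?_
  have := (hα (s + j)).le
  gcongr

/-- Coercivity is required only along the trajectory and only summed over a window: a single
Laplacian may be degenerate, and constant vectors, which the trajectory avoids by having zero mean,
always lie in the kernel. -/
theorem tendsto_zero_of_persistent_excitation (hK : 0 ≤ K) (hAK : ∀ k v, ‖A k v‖ ≤ K * ‖v‖)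
    (hα : ∀ k, 0 < α k) (hanti : Antitone α) (hα0 : Tendsto α atTop (𝓝 0))
    (hsum : Tendsto (fun n => ∑ k ∈ Finset.range n, α k) atTop atTop)
    (hratio : IsBoundedUnder (· ≤ ·) atTop (fun k => α k / α (k + 1)))
    (hz : ∀ k, z (k + 1) = z k - α k • A k (z k) + α k • e k)
    (he : Tendsto e atTop (𝓝 0)) {L : ℕ} (hL : 0 < L) (hc : 0 < c)
    (hpos : ∀ k v, 0 ≤ inner ℝ v (A k v))
    (hcoer : ∀ s, c * ‖z s‖ ^ 2 ≤ ∑ j ∈ Finset.range L, inner ℝ (z s) (A (s + j) (z s))) :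
    Tendsto z atTop (𝓝 0) := by
  obtain ⟨B₀, hB₀⟩ := hratio
  rw [eventually_map] at hB₀
  obtain ⟨k₀, hk₀⟩ := eventually_atTop.1 hB₀
  set B := max B₀ 1 with hB_def
  have hB : 1 ≤ B := le_max_right _ _
  have hratio : ∀ k ≥ k₀, α k ≤ B * α (k + 1) := fun k hk => by
    have h1 : α k / α (k + 1) ≤ B := (hk₀ k hk).trans (le_max_left _ _)
    rwa [div_le_iff₀ (hα _)] at h1
  have hBL : 0 < B ^ L := by positivity
  -- In a window `α (s + j) ≥ α s / B ^ L`, so the coercivity constant of the sum weighted by `α`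
  -- loses a factor `B ^ L`.
  set c' := c / B ^ L with hc'_def
  have hc' : 0 < c' := by positivity
  have hsmall : ∀ C D : ℝ, 0 < D → ∀ᶠ s in atTop, C * α s ≤ D := fun C D hD => by
    have : Tendsto (fun s => C * α s) atTop (𝓝 0) := by simpa using hα0.const_mul C
    exact this.eventually_le_const hD
  set ε : ℕ → ℝ := fun s => ∑ j ∈ Finset.range L, ‖e (s + j)‖
  have hε0 : ∀ s, 0 ≤ ε s := fun s => Finset.sum_nonneg fun _ _ => norm_nonneg _
  have hεle : ∀ s, ∀ j < L, ‖e (s + j)‖ ≤ ε s := fun s j hj =>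
    Finset.single_le_sum (f := fun j => ‖e (s + j)‖) (fun _ _ => norm_nonneg _)
      (Finset.mem_range.2 hj)
  have hε : Tendsto ε atTop (𝓝 0) := by
    have : Tendsto ε atTop (𝓝 (∑ j ∈ Finset.range L, 0)) :=
      tendsto_finsetSum _ fun j _ => by
        simpa using (he.comp (tendsto_add_atTop_nat j)).norm
    simpa using this
  have hwin : ∀ᶠ s in atTop,
      ‖z (s + L)‖ ≤ (1 - c' / 4 * α s) * ‖z s‖ + α s * ((1 + L) * ε s) := by
    filter_upwards [eventually_ge_atTop k₀, hsmall (K * L) (1 / 2) (by norm_num),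
      hsmall c' 1 one_pos, hsmall ((L * K) ^ 2) c' hc',
      hsmall (L ^ 2 * K * (2 * (K + 1))) (c' / 4) (by positivity),
      hsmall (L ^ 2 * K * (2 * (K + 1))) 1 one_pos] with s h0 h1 h2 h3 h4 h5
    refine norm_window_le hK hAK hα hanti hz h1 (hεle s) (hε0 s) ?_ h2
      (by linarith) (by linarith) (by linarith)
    have h6 : α s / B ^ L * (c * ‖z s‖ ^ 2) ≤
        α s / B ^ L * ∑ j ∈ Finset.range L, inner ℝ (z s) (A (s + j) (z s)) :=
      mul_le_mul_of_nonneg_left (hcoer s) (by have := hα s; positivity)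
    calc c' * α s * ‖z s‖ ^ 2 = α s / B ^ L * (c * ‖z s‖ ^ 2) := by rw [hc'_def]; ring
      _ ≤ _ := h6
      _ ≤ _ := by
        rw [Finset.mul_sum]
        refine Finset.sum_le_sum fun j hj => mul_le_mul_of_nonneg_right ?_ (hpos _ _)
        rw [div_le_iff₀ hBL, mul_comm]
        exact le_pow_mul_of_ratio_le hB hα hratio h0 j (Finset.mem_range.1 hj).le
  have hmul : Tendsto (fun m : ℕ => m * L) atTop atTop := tendsto_id.atTop_mul_const' hL
  have hsub : Tendsto (fun m => ‖z (m * L)‖) atTop (𝓝 0) := by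
    refine tendsto_zero_of_le_one_sub_mul_add (a := fun m => c' / 4 * α (m * L))
      (ε := fun m => 4 / c' * ((1 + L) * ε (m * L))) (fun _ => norm_nonneg _) ?_ ?_ ?_ ?_
    · filter_upwards [hmul.eventually (hsmall (c' / 4) 1 one_pos)] with m hm
      exact ⟨by have := hα (m * L); positivity, hm⟩
    · simp_rw [← Finset.mul_sum]
      exact (tendsto_sum_mul_atTop hanti hL hsum).const_mul_atTop (by positivity)
    · simpa using ((hε.comp hmul).const_mul (1 + L : ℝ)).const_mul (4 / c')
    · filter_upwards [hmul.eventually hwin] with m hm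
      rw [Nat.succ_mul]
      refine hm.trans_eq ?_
      field_simp
  -- From multiples of `L` to all times: `k` lies less than `L` steps after `k / L * L`, and the
  -- displacement bound applies.
  have hdiv : Tendsto (fun k : ℕ => k / L) atTop atTop := Nat.tendsto_div_const_atTop hL.ne'
  have hbig : ∀ᶠ k in atTop, ‖z k‖ ≤
      ‖z (k / L * L)‖ + L * (α 0 * (2 * (K + 1)) * (‖z (k / L * L)‖ + ε (k / L * L))) := by
    filter_upwards [(hmul.comp hdiv).eventually (hsmall (K * L) (1 / 2) (by norm_num))] with k hk
    set s := k / L * L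
    have hmod := Nat.mod_lt k hL
    have hks : k = s + k % L := by
      have := Nat.div_add_mod' k L; omega
    have h1 := norm_sub_le_of_linear_step hK hAK hα hanti hz (by simpa using hk) (hεle s) (hε0 s)
      (k % L) hmod.le
    rw [← hks] at h1
    have h2 : ‖z k‖ ≤ ‖z s‖ + ‖z k - z s‖ := by
      have := norm_add_le (z s) (z k - z s)
      simpa using this
    refine h2.trans (by
      gcongr
      refine h1.trans ?_
      have h3 := hε0 s
      have h4 := (hα s).le
      gcongr
      exact hanti (Nat.zero_le _))
  have hv : Tendsto (fun k => ‖z (k / L * L)‖) atTop (𝓝 0) := hsub.comp hdiv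
  have hε' : Tendsto (fun k => ε (k / L * L)) atTop (𝓝 0) := (hε.comp hmul).comp hdiv
  rw [tendsto_zero_iff_norm_tendsto_zero]
  refine tendsto_of_tendsto_of_tendsto_of_le_of_le' tendsto_const_nhds ?_
    (Eventually.of_forall fun _ => norm_nonneg _) hbig
  simpa using hv.add (((hv.add hε').const_mul (α 0 * (2 * (K + 1)))).const_mul (L : ℝ))

end Window

/-! ### Graph Laplacians and deterministic consensus -/

section Graph

lemma abs_sub_le_length_mul {ι : Type*} {G : SimpleGraph ι} {z : ι → ℝ} {δ : ℝ}
    (h : ∀ i j, G.Adj i j → |z i - z j| ≤ δ) {i j : ι} (p : G.Walk i j) :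
    |z i - z j| ≤ p.length * δ := by
  induction p with
  | nil => simp
  | cons hadj q ih =>
    rw [SimpleGraph.Walk.length_cons]
    push_cast
    have := abs_sub_le (z _) (z _) (z _) |>.trans (add_le_add (h _ _ hadj) ih)
    linarith

variable {ι : Type*} [Fintype ι]

/-- A Poincaré inequality on a finite connected graph. -/
lemma sum_sq_le_of_connected {G : SimpleGraph ι} (hG : G.Connected) {z : ι → ℝ}
    (hz : ∑ i, z i = 0) {Q : ℝ} (hQ0 : 0 ≤ Q)
    (hQ : ∀ i j, G.Adj i j → (z i - z j) ^ 2 ≤ Q) :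
    ∑ i, z i ^ 2 ≤ (Fintype.card ι : ℝ) ^ 3 * Q := by
  classical
  have := hG.nonempty
  have hn : (0 : ℝ) < Fintype.card ι := by exact_mod_cast Fintype.card_pos
  set n : ℝ := (Fintype.card ι : ℝ)
  have h1 : ∀ i j, |z i - z j| ≤ n * √Q := by
    intro i j
    obtain ⟨p⟩ := hG.preconnected i j
    refine (abs_sub_le_length_mul (fun a b hab => Real.abs_le_sqrt (hQ a b hab))
      p.bypass).trans ?_
    have : (p.bypass.length : ℝ) ≤ n :=
      Nat.cast_le.2 p.bypass_isPath.length_lt.le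
    gcongr
  have h2 : ∀ i, |z i| ≤ n * √Q := by
    intro i
    -- Zero mean passes the bound from differences to entries. The cube in the claim is `n ^ 2` from
    -- the squared path length times `n` entries.
    have h3 : n * z i = ∑ j, (z i - z j) := by simp [hz, n]
    have h4 : n * |z i| ≤ n * (n * √Q) := by
      rw [← abs_of_pos hn, ← abs_mul, abs_of_pos hn, h3]
      refine (Finset.abs_sum_le_sum_abs _ _).trans ((Finset.sum_le_sum fun j _ => h1 i j).trans ?_)
      simp [n]
    exact le_of_mul_le_mul_left h4 hn
  calc ∑ i, z i ^ 2 ≤ ∑ _i : ι, n ^ 2 * Q := by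
        refine Finset.sum_le_sum fun i _ => ?_
        rw [← sq_abs]
        refine (pow_le_pow_left₀ (abs_nonneg _) (h2 i) 2).trans_eq ?_
        rw [mul_pow, Real.sq_sqrt hQ0]
    _ = n ^ 3 * Q := by simp [n]; ring

/-- The Laplacian of a weighted graph. -/
def laplacian (w : ι → ι → ℝ) : EuclideanSpace ℝ ι →ₗ[ℝ] EuclideanSpace ℝ ι where
  toFun v := WithLp.toLp 2 fun i => ∑ j, w i j * (v i - v j)
  map_add' u v := by
    ext i
    simp only [PiLp.add_apply, ← Finset.sum_add_distrib]
    exact Finset.sum_congr rfl fun j _ => by ring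
  map_smul' r v := by
    ext i
    simp only [PiLp.smul_apply, smul_eq_mul, RingHom.id_apply, Finset.mul_sum]
    exact Finset.sum_congr rfl fun j _ => by ring

@[simp] lemma laplacian_apply (w : ι → ι → ℝ) (v : EuclideanSpace ℝ ι) (i : ι) :
    laplacian w v i = ∑ j, w i j * (v i - v j) := rfl

lemma sum_laplacian {w : ι → ι → ℝ} (hw : ∀ i j, w i j = w j i) (v : EuclideanSpace ℝ ι) :
    ∑ i, laplacian w v i = 0 := by
  have h : ∑ i, laplacian w v i = -∑ i, laplacian w v i := by
    simp only [laplacian_apply]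
    conv_rhs => rw [Finset.sum_comm, ← Finset.sum_neg_distrib]
    refine Finset.sum_congr rfl fun i _ => ?_
    rw [← Finset.sum_neg_distrib]
    exact Finset.sum_congr rfl fun j _ => by rw [hw i j]; ring
  linarith

/-- Symmetrising in `i` and `j` produces the Dirichlet form, hence positivity and control of the
differences along edges. -/
lemma inner_laplacian {w : ι → ι → ℝ} (hw : ∀ i j, w i j = w j i) (v : EuclideanSpace ℝ ι) :
    inner ℝ v (laplacian w v) = 1 / 2 * ∑ i, ∑ j, w i j * (v i - v j) ^ 2 := by
  have h1 : inner ℝ v (laplacian w v) = ∑ i, ∑ j, w i j * (v i - v j) * v i := by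
    simp [PiLp.inner_apply, Finset.sum_mul]
  have h2 : inner ℝ v (laplacian w v) = -∑ i, ∑ j, w i j * (v i - v j) * v j := by
    rw [h1, Finset.sum_comm, ← Finset.sum_neg_distrib]
    refine Finset.sum_congr rfl fun i _ => ?_
    rw [← Finset.sum_neg_distrib]
    exact Finset.sum_congr rfl fun j _ => by rw [hw i j]; ring
  have h3 : ∑ i, ∑ j, w i j * (v i - v j) ^ 2 =
      ∑ i, ∑ j, w i j * (v i - v j) * v i - ∑ i, ∑ j, w i j * (v i - v j) * v j := by
    simp only [← Finset.sum_sub_distrib]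
    exact Finset.sum_congr rfl fun i _ => Finset.sum_congr rfl fun j _ => by ring
  linarith

lemma norm_laplacian_le {w : ι → ι → ℝ} {b : ℝ} (hb : ∀ i j, |w i j| ≤ b)
    (v : EuclideanSpace ℝ ι) :
    ‖laplacian w v‖ ≤ (Fintype.card ι * (Fintype.card ι * (b * 2))) * ‖v‖ := by
  have h0 : ‖laplacian w v‖ ≤ ∑ i, |laplacian w v i| := by
    rw [EuclideanSpace.norm_eq]
    refine Real.sqrt_le_iff.2 ⟨Finset.sum_nonneg fun _ _ => abs_nonneg _, ?_⟩
    exact Finset.sum_sq_le_sq_sum_of_nonneg fun _ _ => abs_nonneg _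
  have h1 : ∀ i, |v i| ≤ ‖v‖ := fun i => PiLp.norm_apply_le v i
  refine h0.trans ?_
  calc ∑ i, |laplacian w v i| ≤ ∑ _i : ι, ∑ _j : ι, b * (2 * ‖v‖) := by
        refine Finset.sum_le_sum fun i _ => (Finset.abs_sum_le_sum_abs _ _).trans ?_
        refine Finset.sum_le_sum fun j _ => ?_
        rw [abs_mul]
        have h2 : |v i - v j| ≤ 2 * ‖v‖ := by
          have := abs_sub (v i) (v j); have := h1 i; have := h1 j; linarith
        exact mul_le_mul (hb i j) h2 (abs_nonneg _) ((abs_nonneg _).trans (hb i j))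
    _ = _ := by simp; ring

/-- Consensus of a weighted averaging iteration over jointly connected undirected graphs, driven
by a perturbation whose series converges. -/
theorem exists_tendsto_of_jointlyConnected {G : ℕ → SimpleGraph ι} {w : ℕ → ι → ι → ℝ}
    (hw : ∀ k i j, w k i j = w k j i) (hw0 : ∀ k i j, 0 ≤ w k i j) {b : ℝ}
    (hb : ∀ k i j, w k i j ≤ b) {m : ℝ} (hm : 0 < m) (hadj : ∀ k i j, (G k).Adj i j → m ≤ w k i j)
    {L : ℕ} (hL : 0 < L) (hconn : ∀ k : ℕ, (⨆ t ∈ Finset.Ico k (k + L), G t).Connected)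
    {α : ℕ → ℝ} (hα : ∀ k, 0 < α k) (hanti : Antitone α) (hα0 : Tendsto α atTop (𝓝 0))
    (hsum : Tendsto (fun n => ∑ k ∈ Finset.range n, α k) atTop atTop)
    (hratio : IsBoundedUnder (· ≤ ·) atTop (fun k => α k / α (k + 1)))
    {x d : ℕ → ι → ℝ}
    (hx : ∀ k i, x (k + 1) i = x k i - α k * ∑ j, w k i j * (x k i - x k j) + d k i)
    {D : ι → ℝ} (hd : ∀ i, Tendsto (fun n => ∑ k ∈ Finset.range n, d k i) atTop (𝓝 (D i))) :
    ∃ c, ∀ i, Tendsto (fun k => x k i) atTop (𝓝 c) := by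
  classical
  have hne : Nonempty ι := (hconn 0).nonempty
  have hn : (0 : ℝ) < Fintype.card ι := by exact_mod_cast Fintype.card_pos
  set n : ℝ := (Fintype.card ι : ℝ)
  have hbabs : ∀ k i j, |w k i j| ≤ b := fun k i j => by
    rw [abs_of_nonneg (hw0 k i j)]; exact hb k i j
  have hb0 : 0 ≤ b := (hw0 0 hne.some hne.some).trans (hb _ _ _)
  -- `R k` is the tail of the perturbation series. Since `R (k + 1) = R k - d k`, the sum `x + R`
  -- satisfies the recursion with `d` replaced by `α k • laplacian (w k) (R k)`, and `R` tends to
  -- zero.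
  set R : ℕ → EuclideanSpace ℝ ι := fun k =>
    WithLp.toLp 2 fun i => D i - ∑ l ∈ Finset.range k, d l i with hR
  have hRi : ∀ i, Tendsto (fun k => R k i) atTop (𝓝 0) := fun i => by
    simpa [hR] using (hd i).const_sub (D i)
  have hR0 : Tendsto R atTop (𝓝 0) := by
    have h1 : Tendsto (fun k => (fun i => R k i)) atTop (𝓝 (fun _ => 0)) :=
      tendsto_pi_nhds.2 hRi
    exact ((PiLp.continuous_toLp 2 (fun _ : ι => ℝ)).tendsto _).comp h1
  -- The average of `x + R` is conserved, because Laplacians of symmetric weights have zero sum; so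
  -- this is the consensus value.
  set c := (∑ i, (x 0 i + R 0 i)) / n with hc
  set z : ℕ → EuclideanSpace ℝ ι := fun k => WithLp.toLp 2 fun i => x k i + R k i - c with hz_def
  set e : ℕ → EuclideanSpace ℝ ι := fun k => laplacian (w k) (R k)
  have hz : ∀ k, z (k + 1) = z k - α k • laplacian (w k) (z k) + α k • e k := by
    intro k
    ext i
    have hRk : R (k + 1) i = R k i - d k i := by
      simp [hR, Finset.sum_range_succ]; ring
    simp only [hz_def, e, PiLp.add_apply, PiLp.sub_apply, PiLp.smul_apply, smul_eq_mul,
      laplacian_apply, hx k i, hRk]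
    have : ∑ j, w k i j * (x k i + R k i - c - (x k j + R k j - c)) =
        ∑ j, w k i j * (x k i - x k j) + ∑ j, w k i j * (R k i - R k j) := by
      rw [← Finset.sum_add_distrib]
      exact Finset.sum_congr rfl fun j _ => by ring
    rw [this]
    ring
  have hzsum : ∀ k, ∑ i, z k i = 0 := by
    intro k
    induction k with
    | zero =>
      simp only [hz_def, Finset.sum_sub_distrib, hc]
      rw [Finset.sum_const, Finset.card_univ, nsmul_eq_mul, mul_div_cancel₀ _ hn.ne', sub_self]
    | succ k ih =>
      rw [hz k]
      simp only [PiLp.add_apply, PiLp.sub_apply, PiLp.smul_apply, smul_eq_mul,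
        Finset.sum_add_distrib, Finset.sum_sub_distrib, ← Finset.mul_sum, e, ih,
        sum_laplacian (hw k)]
      simp
  have he : Tendsto e atTop (𝓝 0) := by
    rw [tendsto_zero_iff_norm_tendsto_zero]
    refine squeeze_zero (fun _ => norm_nonneg _) (fun k => norm_laplacian_le (hbabs k) (R k)) ?_
    simpa using hR0.norm.const_mul (n * (n * (b * 2)))
  have hpos : ∀ k v, 0 ≤ inner ℝ v (laplacian (w k) v) := fun k v => by
    rw [inner_laplacian (hw k)]
    have := Finset.sum_nonneg fun i (_ : i ∈ Finset.univ) => Finset.sum_nonneg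
      fun j (_ : j ∈ Finset.univ) => mul_nonneg (hw0 k i j) (sq_nonneg (v i - v j))
    linarith
  -- The factor `2 / m` comes from the `1 / 2` in the Dirichlet form and the lower bound `m` on edge
  -- weights, and `n ^ 3` from the Poincaré inequality.
  have hcoer : ∀ s, m / (2 * n ^ 3) * ‖z s‖ ^ 2 ≤
      ∑ j ∈ Finset.range L, inner ℝ (z s) (laplacian (w (s + j)) (z s)) := by
    intro s
    set Q := ∑ j ∈ Finset.range L, inner ℝ (z s) (laplacian (w (s + j)) (z s))
    have hQ0 : 0 ≤ Q := Finset.sum_nonneg fun _ _ => hpos _ _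
    have hQ : ∀ i j, (⨆ t ∈ Finset.Ico s (s + L), G t).Adj i j →
        (z s i - z s j) ^ 2 ≤ 2 / m * Q := by
      intro i j hij
      simp only [SimpleGraph.iSup_adj] at hij
      obtain ⟨t, ht, hij⟩ := hij
      obtain ⟨l, rfl⟩ := Nat.exists_eq_add_of_le (Finset.mem_Ico.1 ht).1
      have hl : l ∈ Finset.range L := by
        have := (Finset.mem_Ico.1 ht).2; rw [Finset.mem_range]; omega
      have h1 : inner ℝ (z s) (laplacian (w (s + l)) (z s)) ≤ Q :=
        Finset.single_le_sum (f := fun j => inner ℝ (z s) (laplacian (w (s + j)) (z s)))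
          (fun _ _ => hpos _ _) hl
      rw [inner_laplacian (hw _)] at h1
      have hterm : ∀ i j, 0 ≤ w (s + l) i j * (z s i - z s j) ^ 2 := fun i j =>
        mul_nonneg (hw0 _ i j) (sq_nonneg _)
      have h2 : w (s + l) i j * (z s i - z s j) ^ 2 ≤
          ∑ i, ∑ j, w (s + l) i j * (z s i - z s j) ^ 2 :=
        (Finset.single_le_sum (f := fun j => w (s + l) i j * (z s i - z s j) ^ 2)
          (fun j _ => hterm i j) (Finset.mem_univ j)).trans
        (Finset.single_le_sum (f := fun i => ∑ j, w (s + l) i j * (z s i - z s j) ^ 2)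
          (fun i _ => Finset.sum_nonneg fun j _ => hterm i j) (Finset.mem_univ i))
      have h3 : m * (z s i - z s j) ^ 2 ≤ w (s + l) i j * (z s i - z s j) ^ 2 :=
        mul_le_mul_of_nonneg_right (hadj _ i j hij) (sq_nonneg _)
      rw [div_mul_eq_mul_div, le_div_iff₀ hm]
      linarith
    have h4 := sum_sq_le_of_connected (hconn s) (hzsum s) (by positivity) hQ
    have h5 : ‖z s‖ ^ 2 = ∑ i, z s i ^ 2 := by
      rw [EuclideanSpace.norm_sq_eq]; simp
    rw [h5, div_mul_eq_mul_div, div_le_iff₀ (by positivity)]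
    refine (mul_le_mul_of_nonneg_left h4 hm.le).trans_eq ?_
    simp only [n]
    field_simp
  have hz0 := tendsto_zero_of_persistent_excitation (by positivity)
    (fun k v => norm_laplacian_le (hbabs k) v) hα hanti hα0 hsum hratio hz he hL
    (by positivity) hpos hcoer
  refine ⟨c, fun i => ?_⟩
  have hzi : Tendsto (fun k => z k i) atTop (𝓝 0) :=
    ((EuclideanSpace.proj (𝕜 := ℝ) i).continuous.tendsto 0).comp hz0
  have := (hzi.sub (hRi i)).add_const c
  simp only [hz_def, sub_zero, zero_add] at this
  refine this.congr fun k => by ring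

end Graph

/-! ### Moments of the complex Gaussian law -/

lemma measurable_complex_mk : Measurable (fun z : ℝ × ℝ => (⟨z.1, z.2⟩ : ℂ)) := by
  simp_rw [Complex.mk_eq_add_mul_I]
  fun_prop

lemma memLp_id_complexGaussian (v : ℝ≥0) {p : ENNReal} (hp : p ≠ ⊤) :
    MemLp (fun z => z) p (complexGaussian v) := by
  have h : MemLp (fun x : ℝ => x) p (gaussianReal 0 (v / 2)) := memLp_id_gaussianReal' p hp
  have h1 : MemLp (fun z : ℝ × ℝ => (z.1 : ℂ)) p
      ((gaussianReal 0 (v / 2)).prod (gaussianReal 0 (v / 2))) := (h.comp_fst _).ofReal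
  have h2 : MemLp (fun z : ℝ × ℝ => (z.2 : ℂ)) p
      ((gaussianReal 0 (v / 2)).prod (gaussianReal 0 (v / 2))) := (h.comp_snd _).ofReal
  have h3 := h1.add (h2.mul_const Complex.I)
  have h4 : (fun z : ℝ × ℝ => (⟨z.1, z.2⟩ : ℂ)) =
      (fun z : ℝ × ℝ => (z.1 : ℂ)) + fun z : ℝ × ℝ => (z.2 : ℂ) * Complex.I :=
    funext fun z => Complex.mk_eq_add_mul_I _ _
  rw [← h4] at h3
  exact (memLp_map_measure_iff measurable_id.aestronglyMeasurable
    measurable_complex_mk.aemeasurable).2 h3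

lemma integral_id_complexGaussian (v : ℝ≥0) : ∫ z, z ∂complexGaussian v = 0 := by
  rw [complexGaussian, integral_map measurable_complex_mk.aemeasurable (by fun_prop)]
  have h : Integrable (fun x : ℝ => x) (gaussianReal 0 (v / 2)) :=
    memLp_one_iff_integrable.1 (memLp_id_gaussianReal' 1 (by simp))
  simp_rw [Complex.mk_eq_add_mul_I]
  rw [integral_add (h.comp_fst _).ofReal ((h.comp_snd _).ofReal.mul_const _),
    integral_fun_fst (fun x : ℝ => (x : ℂ)), integral_fun_snd (fun x : ℝ => (x : ℂ) * Complex.I),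
    integral_mul_const, integral_complex_ofReal, integral_id_gaussianReal]
  simp

lemma integral_sq_gaussianReal (v : ℝ≥0) : ∫ x, x ^ 2 ∂gaussianReal 0 v = v := by
  have h := variance_eq_sub (memLp_id_gaussianReal' (μ := 0) (v := v) 2 (by simp))
  rw [variance_id_gaussianReal] at h
  simpa [integral_id_gaussianReal] using h.symm

lemma integral_norm_sq_complexGaussian (v : ℝ≥0) : ∫ z, ‖z‖ ^ 2 ∂complexGaussian v = v := by
  rw [complexGaussian, integral_map measurable_complex_mk.aemeasurable (by fun_prop)]
  have h : Integrable (fun x : ℝ => x ^ 2) (gaussianReal 0 (v / 2)) :=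
    (memLp_id_gaussianReal' 2 (by simp)).integrable_sq
  have h1 : ∀ z : ℝ × ℝ, ‖(⟨z.1, z.2⟩ : ℂ)‖ ^ 2 = z.1 ^ 2 + z.2 ^ 2 := fun z => by
    rw [Complex.sq_norm, Complex.normSq_mk]; ring
  simp_rw [h1]
  rw [integral_add (h.comp_fst _) (h.comp_snd _), integral_fun_fst (fun x : ℝ => x ^ 2),
    integral_fun_snd (fun x : ℝ => x ^ 2), integral_sq_gaussianReal]
  simp

/-! ### Freezing an independent variable -/

section Freezing

variable {Ω β γ : Type*} [MeasurableSpace Ω] [MeasurableSpace β] [MeasurableSpace γ]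
  {μ : Measure Ω} [IsProbabilityMeasure μ] {Z : Ω → β} {W : Ω → γ} {F : β × γ → ℝ}

/-- Fubini for the product law of `(Z, W)`. It takes the place of conditioning on `Z`: with `Z` the
past and `W` the current inputs, moments need only be computed for deterministic states. -/
lemma IndepFun.integral_eq_zero_of_forall (hZ : Measurable Z) (hW : Measurable W)
    (hind : IndepFun Z W μ) (hF : Measurable F) (hint : Integrable (fun ω => F (Z ω, W ω)) μ)
    (h0 : ∀ z, ∫ ω, F (z, W ω) ∂μ = 0) : ∫ ω, F (Z ω, W ω) ∂μ = 0 := by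
  have hmap := hind.map_prod_eq_prod_map_map hZ.aemeasurable hW.aemeasurable
  have hZW : Measurable fun ω => (Z ω, W ω) := hZ.prodMk hW
  have hint' : Integrable F ((μ.map Z).prod (μ.map W)) := by
    rw [← hmap]
    exact (integrable_map_measure hF.aestronglyMeasurable hZW.aemeasurable).2 hint
  have := Measure.isProbabilityMeasure_map (μ := μ) hW.aemeasurable
  rw [← integral_map (f := F) hZW.aemeasurable hF.aestronglyMeasurable, hmap,
    integral_prod _ hint']
  refine (integral_congr_ae (ae_of_all _ fun z => ?_)).trans (integral_zero' _ _)
  change ∫ w, F (z, w) ∂μ.map W = 0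
  rw [integral_map (f := fun w => F (z, w)) hW.aemeasurable
    (hF.comp measurable_prodMk_left).aestronglyMeasurable, h0]

/-- For `F ≥ 0`, Tonelli yields integrability of `F (Z, W)` from the bound `b` on the slice
integrals, so it need not be assumed. -/
lemma IndepFun.integrable_and_integral_le_of_forall (hZ : Measurable Z) (hW : Measurable W)
    (hind : IndepFun Z W μ) (hF : Measurable F) (hF0 : ∀ p, 0 ≤ F p)
    {b : β → ℝ} (hb : Measurable b) (hbint : Integrable (fun ω => b (Z ω)) μ)
    (hint : ∀ z, Integrable (fun ω => F (z, W ω)) μ) (hle : ∀ z, ∫ ω, F (z, W ω) ∂μ ≤ b z) :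
    Integrable (fun ω => F (Z ω, W ω)) μ ∧ ∫ ω, F (Z ω, W ω) ∂μ ≤ ∫ ω, b (Z ω) ∂μ := by
  have hmap := hind.map_prod_eq_prod_map_map hZ.aemeasurable hW.aemeasurable
  have hZW : Measurable fun ω => (Z ω, W ω) := hZ.prodMk hW
  have := Measure.isProbabilityMeasure_map (μ := μ) hW.aemeasurable
  have := Measure.isProbabilityMeasure_map (μ := μ) hZ.aemeasurable
  have hslice : ∀ z, AEStronglyMeasurable (fun w => F (z, w)) (μ.map W) := fun z =>
    (hF.comp measurable_prodMk_left).aestronglyMeasurable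
  have hbint' : Integrable b (μ.map Z) :=
    (integrable_map_measure hb.aestronglyMeasurable hZ.aemeasurable).2 hbint
  have hle' : ∀ z, ∫ w, F (z, w) ∂μ.map W ≤ b z := fun z => by
    rw [integral_map hW.aemeasurable (hslice z)]; exact hle z
  have hint' : Integrable F ((μ.map Z).prod (μ.map W)) := by
    rw [integrable_prod_iff hF.aestronglyMeasurable]
    refine ⟨ae_of_all _ fun z => (integrable_map_measure (hslice z) hW.aemeasurable).2 (hint z),
      hbint'.mono' ?_ (ae_of_all _ fun z => ?_)⟩
    · exact hF.aestronglyMeasurable.norm.integral_prod_right'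
    · simp_rw [Real.norm_of_nonneg (hF0 _)]
      rw [Real.norm_of_nonneg (integral_nonneg fun w => hF0 _)]
      exact hle' z
  constructor
  · rw [← hmap] at hint'
    exact (integrable_map_measure hF.aestronglyMeasurable hZW.aemeasurable).1 hint'
  · rw [← integral_map (f := F) hZW.aemeasurable hF.aestronglyMeasurable, hmap,
      integral_prod _ hint', ← integral_map (f := b) hZ.aemeasurable hb.aestronglyMeasurable]
    exact integral_mono hint'.integral_prod_left hbint' hle'

end Freezing

namespace Inputs

variable {N : ℕ} {S : System N} {Ω : Type*} [mΩ : MeasurableSpace Ω] {μ : Measure Ω}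
  (I : Inputs S μ)

/-! ### The σ-algebras generated by the inputs -/

/-- The inputs, as one family. -/
def family : (ℕ × Fin N) ⊕ ((ℕ × Fin N × Fin N) ⊕ (ℕ × Fin N)) → Ω → ℂ :=
  Sum.elim (fun (s : ℕ × Fin N) (ω : Ω) => (I.γ s.1 s.2 ω : ℂ))
    (Sum.elim (fun (s : ℕ × Fin N × Fin N) (ω : Ω) => I.h s.1 s.2.1 s.2.2 ω)
      (fun (s : ℕ × Fin N) (ω : Ω) => I.n s.1 s.2 ω))

/-- The time at which an input acts. -/
def time : (ℕ × Fin N) ⊕ ((ℕ × Fin N × Fin N) ⊕ (ℕ × Fin N)) → ℕ :=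
  Sum.elim Prod.fst (Sum.elim Prod.fst Prod.fst)

/-- The σ-algebra generated by the inputs with index in `T`. -/
@[reducible] noncomputable def sigma (T : Set ((ℕ × Fin N) ⊕ ((ℕ × Fin N × Fin N) ⊕ (ℕ × Fin N)))) : MeasurableSpace Ω :=
  ⨆ s ∈ T, MeasurableSpace.comap (I.family s) inferInstance

lemma measurable_family (s) : Measurable (I.family s) := by
  rcases s with s | s | s
  · exact Complex.measurable_ofReal.comp (I.measurable_γ s.1 s.2)
  · exact I.measurable_h s.1 s.2.1 s.2.2
  · exact I.measurable_n s.1 s.2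

lemma sigma_le (T) : I.sigma T ≤ mΩ :=
  iSup₂_le fun s _ => (I.measurable_family s).comap_le

lemma sigma_mono {T T'} (h : T ⊆ T') : I.sigma T ≤ I.sigma T' :=
  biSup_mono h

variable {I} in
lemma measurable_family_of_mem {T} {s} (hs : s ∈ T) : Measurable[I.sigma T] (I.family s) :=
  measurable_iff_comap_le.2
    (le_iSup₂_of_le (f := fun s (_ : s ∈ T) => MeasurableSpace.comap (I.family s) inferInstance)
      s hs le_rfl)

variable {I} in
lemma measurable_γ_of_mem {T} {k : ℕ} {i : Fin N} (hs : Sum.inl (k, i) ∈ T) :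
    Measurable[I.sigma T] (I.γ k i) := by
  have := Complex.measurable_re.comp (measurable_family_of_mem (I := I) hs)
  exact this

variable {I} in
lemma measurable_h_of_mem {T} {k : ℕ} {i j : Fin N} (hs : Sum.inr (Sum.inl (k, i, j)) ∈ T) :
    Measurable[I.sigma T] (I.h k i j) :=
  measurable_family_of_mem (I := I) hs

variable {I} in
lemma measurable_n_of_mem {T} {k : ℕ} {i : Fin N} (hs : Sum.inr (Sum.inr (k, i)) ∈ T) :
    Measurable[I.sigma T] (I.n k i) :=
  measurable_family_of_mem (I := I) hs

/-- Every independence claim about the inputs reduces to disjointness of two index sets. -/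
lemma indepFun_of_disjoint {T T'} (hT : Disjoint T T') {β γ : Type*} [MeasurableSpace β]
    [MeasurableSpace γ] {f : Ω → β} {g : Ω → γ} (hf : Measurable[I.sigma T] f)
    (hg : Measurable[I.sigma T'] g) : IndepFun f g μ := by
  have h1 : iIndep (fun s => MeasurableSpace.comap (I.family s) inferInstance) μ := I.indep
  have h2 : Indep (I.sigma T) (I.sigma T') μ :=
    indep_iSup_of_disjoint (fun s => (I.measurable_family s).comap_le) h1 hT
  rw [IndepFun_iff_Indep]
  exact indep_of_indep_of_le_left (indep_of_indep_of_le_right h2 hg.comap_le) hf.comap_le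

/-- The information available before time `k`. -/
noncomputable def past : Filtration ℕ mΩ where
  seq k := I.sigma {s | time s < k}
  mono' _ _ hkl := I.sigma_mono fun _ hs => lt_of_lt_of_le hs hkl
  le' _ := I.sigma_le _

/-- The inputs of agent `i` at time `k`. -/
def current (k : ℕ) (i : Fin N) (ω : Ω) : (Fin N → ℝ) × (Fin N → ℂ) × ℂ :=
  (fun j => I.γ k j ω, fun j => I.h k i j ω, I.n k i ω)

lemma measurable_current_sigma (k : ℕ) (i : Fin N) :
    Measurable[I.sigma {s | time s = k}] (I.current k i) := by
  refine Measurable.prodMk ?_ (Measurable.prodMk ?_ ?_)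
  · exact @measurable_pi_lambda _ _ _ (I.sigma _) _ _ fun j => measurable_γ_of_mem rfl
  · exact @measurable_pi_lambda _ _ _ (I.sigma _) _ _ fun j => measurable_h_of_mem rfl
  · exact measurable_n_of_mem rfl

lemma indepFun_current {k : ℕ} {i : Fin N} {β : Type*} [MeasurableSpace β] {Z : Ω → β}
    (hZ : Measurable[I.past k] Z) : IndepFun Z (I.current k i) μ := by
  have hdisj : Disjoint {s | time (N := N) s < k} {s | time (N := N) s = k} := by
    rw [Set.disjoint_left]
    intro s (h1 : time s < k) (h2 : time s = k)
    exact h1.ne h2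
  have hZ' : Measurable[I.sigma {s | time s < k}] Z := hZ
  exact I.indepFun_of_disjoint hdisj hZ' (I.measurable_current_sigma k i)

end Inputs

/-! ### Power of the transmitted signal -/

lemma System.measurable_signal {N : ℕ} (S : System N) : Measurable S.signal := by
  unfold System.signal Complex.sqrt
  fun_prop

/-- The sent power depends on `|x|` only; this is the source of the absolute values in the mean
step. -/
lemma System.norm_signal_sq {N : ℕ} (S : System N) (x : ℝ) : ‖S.signal x‖ ^ 2 = S.ρ * |x| := by
  unfold System.signal Complex.sqrt
  rw [norm_mul, S.norm_u, mul_one, mul_comm, ← abs_of_pos S.ρ_pos, ← abs_mul, abs_of_pos S.ρ_pos,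
    ← norm_pow]
  rw [← Complex.cpow_nat_mul]
  simp [abs_mul, mul_comm]

lemma System.norm_signal_pow_four {N : ℕ} (S : System N) (x : ℝ) :
    ‖S.signal x‖ ^ 4 = S.ρ ^ 2 * x ^ 2 := by
  have : ‖S.signal x‖ ^ 4 = (‖S.signal x‖ ^ 2) ^ 2 := by ring
  rw [this, S.norm_signal_sq, mul_pow, sq_abs]

lemma integrable_inner_of_memLp_two {Ω E : Type*} [MeasurableSpace Ω] {μ : Measure Ω}
    [NormedAddCommGroup E] [InnerProductSpace ℝ E] {f g : Ω → E} (hf : MemLp f 2 μ)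
    (hg : MemLp g 2 μ) : Integrable (fun ω => inner ℝ (f ω) (g ω)) μ :=
  (hf.norm.integrable_mul hg.norm).mono' (hf.1.inner hg.1)
    (ae_of_all _ fun _ => norm_inner_le_norm _ _)

namespace Inputs

variable {N : ℕ} {S : System N} {Ω : Type*} [mΩ : MeasurableSpace Ω] {μ : Measure Ω}
  (I : Inputs S μ)

/-! ### Moments of the received signal -/

lemma memLp_h (k : ℕ) (i j : Fin N) {p : ENNReal} (hp : p ≠ ⊤) : MemLp (I.h k i j) p μ := by
  have h := memLp_id_complexGaussian (S.Λ i j) hp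
  rw [← (I.h_law k i j).map_eq] at h
  exact h.comp_of_map (I.measurable_h k i j).aemeasurable

lemma memLp_n (k : ℕ) (i : Fin N) {p : ENNReal} (hp : p ≠ ⊤) : MemLp (I.n k i) p μ := by
  have h := memLp_id_complexGaussian (S.σ i ^ 2) hp
  rw [← (I.n_law k i).map_eq] at h
  exact h.comp_of_map (I.measurable_n k i).aemeasurable

lemma integral_h (k : ℕ) (i j : Fin N) : ∫ ω, I.h k i j ω ∂μ = 0 :=
  (I.h_law k i j).integral_eq.trans (integral_id_complexGaussian _)

lemma integral_n (k : ℕ) (i : Fin N) : ∫ ω, I.n k i ω ∂μ = 0 :=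
  (I.n_law k i).integral_eq.trans (integral_id_complexGaussian _)

lemma integral_norm_sq_h (k : ℕ) (i j : Fin N) : ∫ ω, ‖I.h k i j ω‖ ^ 2 ∂μ = S.Λ i j := by
  rw [← integral_norm_sq_complexGaussian]
  exact (I.h_law k i j).integral_comp (f := fun z : ℂ => ‖z‖ ^ 2) (by fun_prop)

lemma integral_norm_sq_n (k : ℕ) (i : Fin N) : ∫ ω, ‖I.n k i ω‖ ^ 2 ∂μ = (S.σ i : ℝ) ^ 2 := by
  have h := (I.n_law k i).integral_comp (f := fun z : ℂ => ‖z‖ ^ 2) (by fun_prop)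
  rw [integral_norm_sq_complexGaussian] at h
  exact_mod_cast h

lemma Γ_sq (k : ℕ) (i j : Fin N) (ω : Ω) : I.Γ k i j ω ^ 2 = I.Γ k i j ω := by
  unfold Γ
  rcases I.γ_zero_or_one k i ω with h | h <;> rcases I.γ_zero_or_one k j ω with h' | h' <;>
    simp [h, h']

lemma abs_Γ_le_one (k : ℕ) (i j : Fin N) (ω : Ω) : |I.Γ k i j ω| ≤ 1 := by
  unfold Γ
  rcases I.γ_zero_or_one k i ω with h | h <;> rcases I.γ_zero_or_one k j ω with h' | h' <;>
    simp [h, h']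

lemma measurable_Γ_of_mem {T} {k : ℕ} {i j : Fin N} (hi : Sum.inl (k, i) ∈ T)
    (hj : Sum.inl (k, j) ∈ T) : Measurable[I.sigma T] (I.Γ k i j) := by
  have h1 := measurable_γ_of_mem (I := I) hi
  have h2 := measurable_γ_of_mem (I := I) hj
  exact (h1.mul (measurable_const.sub h2)).add (h2.mul (measurable_const.sub h1))

lemma measurable_Γ (k : ℕ) (i j : Fin N) : Measurable (I.Γ k i j) :=
  ((I.measurable_γ k i).mul (measurable_const.sub (I.measurable_γ k j))).add
    ((I.measurable_γ k j).mul (measurable_const.sub (I.measurable_γ k i)))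

lemma γ_eq_indicator (k : ℕ) (i : Fin N) :
    I.γ k i = Set.indicator {ω | I.γ k i ω = 1} 1 := by
  ext ω
  rcases I.γ_zero_or_one k i ω with h | h <;> simp [h]

lemma integral_γ (k : ℕ) (i : Fin N) : ∫ ω, I.γ k i ω ∂μ = S.p i := by
  have hm : MeasurableSet {ω | I.γ k i ω = 1} :=
    I.measurable_γ k i (measurableSet_singleton (1 : ℝ))
  rw [I.γ_eq_indicator k i, integral_indicator_one hm, measureReal_def, I.γ_law,
    ENNReal.toReal_ofReal (S.p_mem i).1.le]

/-- The contribution of agent `j` to the signal received by agent `i`. -/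
noncomputable def contribution (k : ℕ) (x : Fin N → ℝ) (i j : Fin N) (ω : Ω) : ℂ :=
  (I.Γ k i j ω : ℂ) * I.h k i j ω * S.signal (x j)

lemma norm_contribution_le (k : ℕ) (x : Fin N → ℝ) (i j : Fin N) (ω : Ω) :
    ‖I.contribution k x i j ω‖ ≤ ‖I.h k i j ω‖ * ‖S.signal (x j)‖ := by
  unfold contribution
  rw [norm_mul, norm_mul, Complex.norm_real]
  gcongr
  exact mul_le_of_le_one_left (norm_nonneg _) (I.abs_Γ_le_one k i j ω)

lemma measurable_contribution (k : ℕ) (x : Fin N → ℝ) (i j : Fin N) :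
    Measurable (I.contribution k x i j) :=
  ((Complex.measurable_ofReal.comp (I.measurable_Γ k i j)).mul (I.measurable_h k i j)).mul
    measurable_const

lemma memLp_contribution (k : ℕ) (x : Fin N → ℝ) (i j : Fin N) {p : ENNReal} (hp : p ≠ ⊤) :
    MemLp (I.contribution k x i j) p μ := by
  refine ((I.memLp_h k i j hp).mul_const (S.signal (x j))).mono
    (I.measurable_contribution k x i j).aestronglyMeasurable (ae_of_all _ fun ω => ?_)
  rw [norm_mul]
  exact I.norm_contribution_le k x i j ω

lemma memLp_received (k : ℕ) (x : Fin N → ℝ) (i : Fin N) {p : ENNReal} (hp : p ≠ ⊤) :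
    MemLp (I.received k x i) p μ := by
  classical
  exact (memLp_finsetSum _ fun j _ => I.memLp_contribution k x i j hp).add (I.memLp_n k i hp)

/-- The power mean inequality is applied twice: `8 = 2 ^ 3` separates the noise from the signals and
`N ^ 3` separates the agents. -/
lemma norm_received_pow_four_le (k : ℕ) (x : Fin N → ℝ) (i : Fin N) (ω : Ω) :
    ‖I.received k x i ω‖ ^ 4 ≤ 8 * (N ^ 3 * ∑ j, ‖I.h k i j ω‖ ^ 4 * (S.ρ ^ 2 * x j ^ 2)
      + ‖I.n k i ω‖ ^ 4) := by
  classical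
  have h1 : ‖I.received k x i ω‖ ≤
      (∑ j, ‖I.h k i j ω‖ * ‖S.signal (x j)‖) + ‖I.n k i ω‖ := by
    refine (norm_add_le _ _).trans (add_le_add ?_ le_rfl)
    refine (norm_sum_le_of_le _ fun j _ => I.norm_contribution_le k x i j ω).trans ?_
    exact Finset.sum_le_sum_of_subset_of_nonneg (Finset.filter_subset _ _)
      fun j _ _ => by positivity
  have h2 := pow_sum_le_card_mul_sum_pow (s := Finset.univ)
    (f := fun j => ‖I.h k i j ω‖ * ‖S.signal (x j)‖) (fun j _ => by positivity) 3
  simp only [mul_pow, Nat.reduceAdd, S.norm_signal_pow_four, Finset.card_univ,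
    Fintype.card_fin] at h2
  refine (pow_le_pow_left₀ (norm_nonneg _) h1 4).trans
    ((add_pow_le (Finset.sum_nonneg fun j _ => by positivity) (norm_nonneg _) 4).trans ?_)
  norm_num
  linarith

/-- A bound for the fourth moments of the received signals. -/
noncomputable def momentBound (_ : Inputs S μ) : ℝ :=
  8 * (N ^ 3 * (S.ρ ^ 2 * ∑ i, ∑ j, ∫ z, ‖z‖ ^ 4 ∂complexGaussian (S.Λ i j))
    + ∑ i, ∫ z, ‖z‖ ^ 4 ∂complexGaussian (S.σ i ^ 2))

lemma momentBound_nonneg : 0 ≤ I.momentBound := by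
  unfold momentBound
  have h : ∀ v, 0 ≤ ∫ z, ‖z‖ ^ 4 ∂complexGaussian v := fun v =>
    integral_nonneg fun z => by positivity
  have h1 := Finset.sum_nonneg fun i (_ : i ∈ Finset.univ) => Finset.sum_nonneg
    fun j (_ : j ∈ Finset.univ) => h (S.Λ i j)
  have h2 := Finset.sum_nonneg fun i (_ : i ∈ Finset.univ) => h (S.σ i ^ 2)
  positivity

lemma integrable_norm_received_pow_four (k : ℕ) (x : Fin N → ℝ) (i : Fin N) :
    Integrable (fun ω => ‖I.received k x i ω‖ ^ 4) μ :=
  (I.memLp_received k x i (p := (4 : ℕ)) (by simp)).integrable_norm_pow (by norm_num)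

lemma integral_norm_received_pow_four_le (k : ℕ) (x : Fin N → ℝ) (i : Fin N) :
    ∫ ω, ‖I.received k x i ω‖ ^ 4 ∂μ ≤ I.momentBound * (1 + ∑ j, x j ^ 2) := by
  have hh : ∀ j, Integrable (fun ω => ‖I.h k i j ω‖ ^ 4 * (S.ρ ^ 2 * x j ^ 2)) μ := fun j =>
    ((I.memLp_h k i j (p := (4 : ℕ)) (by simp)).integrable_norm_pow (by norm_num)).mul_const _
  have hn : Integrable (fun ω => ‖I.n k i ω‖ ^ 4) μ :=
    (I.memLp_n k i (p := (4 : ℕ)) (by simp)).integrable_norm_pow (by norm_num)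
  have hs := integrable_finsetSum Finset.univ fun j _ => hh j
  refine (integral_mono (I.integrable_norm_received_pow_four k x i)
    (((hs.const_mul _).add hn).const_mul _) (I.norm_received_pow_four_le k x i)).trans ?_
  have e1 : ∀ j, ∫ ω, ‖I.h k i j ω‖ ^ 4 ∂μ = ∫ z, ‖z‖ ^ 4 ∂complexGaussian (S.Λ i j) := fun j =>
    (I.h_law k i j).integral_comp (f := fun z : ℂ => ‖z‖ ^ 4) (by fun_prop)
  have e2 : ∫ ω, ‖I.n k i ω‖ ^ 4 ∂μ = ∫ z, ‖z‖ ^ 4 ∂complexGaussian (S.σ i ^ 2) :=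
    (I.n_law k i).integral_comp (f := fun z : ℂ => ‖z‖ ^ 4) (by fun_prop)
  have h : ∀ v, 0 ≤ ∫ z, ‖z‖ ^ 4 ∂complexGaussian v := fun v =>
    integral_nonneg fun z => by positivity
  simp only [Pi.add_apply]
  rw [integral_const_mul, integral_add (hs.const_mul _) hn, integral_const_mul,
    integral_finsetSum _ fun j _ => hh j, e2]
  simp_rw [integral_mul_const, e1]
  unfold momentBound
  rw [mul_assoc]
  refine mul_le_mul_of_nonneg_left ?_ (by norm_num)
  set H := ∑ i, ∑ j, ∫ z, ‖z‖ ^ 4 ∂complexGaussian (S.Λ i j)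
  set V := ∑ i, ∫ z, ‖z‖ ^ 4 ∂complexGaussian (S.σ i ^ 2)
  set X := ∑ j, x j ^ 2 with hX
  have hX0 : 0 ≤ X := Finset.sum_nonneg fun j _ => sq_nonneg _
  have hHj : ∀ j, ∫ z, ‖z‖ ^ 4 ∂complexGaussian (S.Λ i j) ≤ H := fun j =>
    (Finset.single_le_sum (f := fun j => ∫ z, ‖z‖ ^ 4 ∂complexGaussian (S.Λ i j))
      (fun j _ => h _) (Finset.mem_univ j)).trans
    (Finset.single_le_sum (f := fun i => ∑ j, ∫ z, ‖z‖ ^ 4 ∂complexGaussian (S.Λ i j))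
      (fun i _ => Finset.sum_nonneg fun j _ => h _) (Finset.mem_univ i))
  have hVi : ∫ z, ‖z‖ ^ 4 ∂complexGaussian (S.σ i ^ 2) ≤ V :=
    Finset.single_le_sum (f := fun i => ∫ z, ‖z‖ ^ 4 ∂complexGaussian (S.σ i ^ 2))
      (fun i _ => h _) (Finset.mem_univ i)
  have hH0 : 0 ≤ H := (h _).trans (hHj i)
  have hV0 : 0 ≤ V := (h _).trans hVi
  have h3 : ∑ j, (∫ z, ‖z‖ ^ 4 ∂complexGaussian (S.Λ i j)) * (S.ρ ^ 2 * x j ^ 2) ≤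
      S.ρ ^ 2 * H * X := by
    rw [hX, Finset.mul_sum]
    refine Finset.sum_le_sum fun j _ => ?_
    have := mul_le_mul_of_nonneg_right (hHj j) (by positivity : 0 ≤ S.ρ ^ 2 * x j ^ 2)
    linarith
  have h4 : (N : ℝ) ^ 3 * ∑ j, (∫ z, ‖z‖ ^ 4 ∂complexGaussian (S.Λ i j)) * (S.ρ ^ 2 * x j ^ 2) ≤
      N ^ 3 * (S.ρ ^ 2 * H * X) := by gcongr
  have h5 : (0 : ℝ) ≤ N ^ 3 * (S.ρ ^ 2 * H) := by positivity
  have h6 : 0 ≤ V * X := by positivity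
  nlinarith

variable [IsProbabilityMeasure μ]

/-- Distinct agents choose slots independently. For `i = j` the left side vanishes and the formula
fails. -/
lemma integral_Γ (k : ℕ) {i j : Fin N} (hij : i ≠ j) :
    ∫ ω, I.Γ k i j ω ∂μ = S.p i * (1 - S.p j) + S.p j * (1 - S.p i) := by
  have hint : ∀ i, Integrable (I.γ k i) μ := fun i =>
    Integrable.of_bound (I.measurable_γ k i).aestronglyMeasurable 1 (ae_of_all _ fun ω => by
      rcases I.γ_zero_or_one k i ω with h | h <;> simp [h])
  have hind : IndepFun (I.γ k i) (I.γ k j) μ :=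
    I.indepFun_of_disjoint (T := {Sum.inl (k, i)}) (T' := {Sum.inl (k, j)})
      (by simpa using hij) (measurable_γ_of_mem rfl) (measurable_γ_of_mem rfl)
  have hmul := hind.integral_fun_mul_eq_mul_integral (hint i).1 (hint j).1
  rw [I.integral_γ, I.integral_γ] at hmul
  have hintm : Integrable (fun ω => I.γ k i ω * I.γ k j ω) μ :=
    hind.integrable_mul (hint i) (hint j)
  have h : ∀ ω, I.Γ k i j ω = I.γ k i ω + I.γ k j ω - 2 * (I.γ k i ω * I.γ k j ω) := fun ω => by
    unfold Γ; ring
  simp_rw [h]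
  have hadd : Integrable (fun ω => I.γ k i ω + I.γ k j ω) μ := (hint i).add (hint j)
  rw [integral_sub hadd (hintm.const_mul 2), integral_add (hint i) (hint j),
    integral_const_mul, hmul, I.integral_γ, I.integral_γ]
  ring

/-- The centred input `s` is independent of `f` and `g` and enters linearly, so integrating over it
first gives zero. -/
lemma integral_inner_eq_zero {T} {s} (hs : s ∉ T) (h0 : ∫ ω, I.family s ω ∂μ = 0)
    (hint : Integrable (I.family s) μ) {f g : Ω → ℂ} (hf : Measurable[I.sigma T] f)
    (hg : Measurable[I.sigma T] g)
    (hfg : Integrable (fun ω => inner ℝ (f ω) (g ω * I.family s ω)) μ) :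
    ∫ ω, inner ℝ (f ω) (g ω * I.family s ω) ∂μ = 0 := by
  have hind : IndepFun (fun ω => (f ω, g ω)) (I.family s) μ :=
    I.indepFun_of_disjoint (T := T) (T' := {s}) (by simpa using hs) (hf.prodMk hg)
      (measurable_family_of_mem rfl)
  refine IndepFun.integral_eq_zero_of_forall
    (F := fun q : (ℂ × ℂ) × ℂ => inner ℝ q.1.1 (q.1.2 * q.2))
    ((hf.mono (I.sigma_le T) le_rfl).prodMk (hg.mono (I.sigma_le T) le_rfl))
    (I.measurable_family s) hind (by fun_prop) hfg fun z => ?_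
  change ∫ ω, inner ℝ z.1 (z.2 * I.family s ω) ∂μ = 0
  rw [integral_inner (hint.const_mul z.2) z.1, integral_const_mul, h0]
  simp

/-- The two contributions share `γ_i`, so their independence is not available. It suffices that
`h_il` is centred and independent of all the other inputs. -/
lemma integral_inner_contribution (k : ℕ) (x : Fin N → ℝ) (i : Fin N) {j l : Fin N}
    (hjl : j ≠ l) :
    ∫ ω, inner ℝ (I.contribution k x i j ω) (I.contribution k x i l ω) ∂μ = 0 := by
  set T : Set ((ℕ × Fin N) ⊕ ((ℕ × Fin N × Fin N) ⊕ (ℕ × Fin N))) :=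
    {Sum.inr (Sum.inl (k, i, l))}ᶜ with hT
  have hΓ : ∀ a, Measurable[I.sigma T] fun ω => (I.Γ k i a ω : ℂ) := fun a =>
    Complex.measurable_ofReal.comp (I.measurable_Γ_of_mem (by simp [hT]) (by simp [hT]))
  have hh : Measurable[I.sigma T] (I.h k i j) := measurable_h_of_mem (by simp [hT, hjl])
  have heq : ∀ ω, I.contribution k x i l ω =
      ((I.Γ k i l ω : ℂ) * S.signal (x l)) * I.family (Sum.inr (Sum.inl (k, i, l))) ω :=
    fun ω => mul_right_comm _ _ _
  have hint := integrable_inner_of_memLp_two (I.memLp_contribution k x i j (p := 2) (by simp))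
    (I.memLp_contribution k x i l (p := 2) (by simp))
  simp_rw [heq] at hint ⊢
  exact I.integral_inner_eq_zero (T := T) (s := Sum.inr (Sum.inl (k, i, l)))
    (by simp [hT]) (I.integral_h k i l)
    (memLp_one_iff_integrable.1 (I.memLp_h k i l (by simp)))
    (((hΓ j).mul hh).mul measurable_const) ((hΓ l).mul measurable_const) hint

lemma integral_inner_contribution_n (k : ℕ) (x : Fin N → ℝ) (i j : Fin N) :
    ∫ ω, inner ℝ (I.contribution k x i j ω) (I.n k i ω) ∂μ = 0 := by
  set T : Set ((ℕ × Fin N) ⊕ ((ℕ × Fin N × Fin N) ⊕ (ℕ × Fin N))) :=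
    {Sum.inr (Sum.inr (k, i))}ᶜ with hT
  have hΓ : Measurable[I.sigma T] fun ω => (I.Γ k i j ω : ℂ) :=
    Complex.measurable_ofReal.comp (I.measurable_Γ_of_mem (by simp [hT]) (by simp [hT]))
  have hh : Measurable[I.sigma T] (I.h k i j) := measurable_h_of_mem (by simp [hT])
  have heq : ∀ ω, I.n k i ω = 1 * I.family (Sum.inr (Sum.inr (k, i))) ω :=
    fun ω => (one_mul _).symm
  have hint := integrable_inner_of_memLp_two (I.memLp_contribution k x i j (p := 2) (by simp))
    (I.memLp_n k i (p := 2) (by simp))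
  simp_rw [heq] at hint ⊢
  exact I.integral_inner_eq_zero (T := T) (s := Sum.inr (Sum.inr (k, i)))
    (g := fun _ => 1) (by simp [hT]) (I.integral_n k i)
    (memLp_one_iff_integrable.1 (I.memLp_n k i (by simp)))
    ((hΓ.mul hh).mul measurable_const) measurable_const hint

lemma integral_norm_contribution_sq (k : ℕ) (x : Fin N → ℝ) {i j : Fin N} (hij : i ≠ j) :
    ∫ ω, ‖I.contribution k x i j ω‖ ^ 2 ∂μ =
      S.ρ * (S.p i * (1 - S.p j) + S.p j * (1 - S.p i)) * S.Λ i j * |x j| := by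
  have heq : ∀ ω, ‖I.contribution k x i j ω‖ ^ 2 =
      (I.Γ k i j ω * ‖I.h k i j ω‖ ^ 2) * (S.ρ * |x j|) := fun ω => by
    unfold contribution
    rw [norm_mul, norm_mul, mul_pow, mul_pow, S.norm_signal_sq, Complex.norm_real, Real.norm_eq_abs,
      sq_abs, I.Γ_sq]
  have hind : IndepFun (I.Γ k i j) (fun ω => ‖I.h k i j ω‖ ^ 2) μ :=
    I.indepFun_of_disjoint (T := Set.range Sum.inl) (T' := Set.range Sum.inr)
      (Set.isCompl_range_inl_range_inr.disjoint)
      (I.measurable_Γ_of_mem (by simp) (by simp))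
      ((measurable_norm.pow_const 2).comp (measurable_h_of_mem (by simp)))
  simp_rw [heq]
  rw [integral_mul_const, hind.integral_fun_mul_eq_mul_integral
    (I.measurable_Γ k i j).aestronglyMeasurable
    ((I.measurable_h k i j).norm.pow_const 2).aestronglyMeasurable, I.integral_Γ k hij,
    I.integral_norm_sq_h]
  ring

/-- Expanding the square leaves only diagonal terms. This mean is what the protocol compensates by
subtracting `σ_i ^ 2` and weighting with `ā_ij`. -/
lemma integral_norm_received_sq (k : ℕ) (x : Fin N → ℝ) (i : Fin N) :
    ∫ ω, ‖I.received k x i ω‖ ^ 2 ∂μ = (S.σ i : ℝ) ^ 2 + ∑ j, S.abar k i j * |x j| := by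
  classical
  set s := Finset.univ.filter fun j => (S.G k).Adj i j with hs
  have hrec : ∀ ω, I.received k x i ω = (∑ j ∈ s, I.contribution k x i j ω) + I.n k i ω := by
    intro ω
    unfold received contribution
    congr!
  have hc : ∀ j, MemLp (I.contribution k x i j) 2 μ := fun j =>
    I.memLp_contribution k x i j (by simp)
  have hn : MemLp (I.n k i) 2 μ := I.memLp_n k i (by simp)
  have hexp : ∀ ω, ‖I.received k x i ω‖ ^ 2 =
      (∑ j ∈ s, ∑ l ∈ s, inner ℝ (I.contribution k x i j ω) (I.contribution k x i l ω))
      + 2 * (∑ j ∈ s, inner ℝ (I.contribution k x i j ω) (I.n k i ω)) + ‖I.n k i ω‖ ^ 2 := by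
    intro ω
    rw [hrec, norm_add_sq_real, sum_inner, ← real_inner_self_eq_norm_sq (∑ j ∈ s, _), sum_inner]
    simp_rw [inner_sum]
  have hi1 : ∀ j l, Integrable (fun ω =>
      inner ℝ (I.contribution k x i j ω) (I.contribution k x i l ω)) μ := fun j l =>
    integrable_inner_of_memLp_two (hc j) (hc l)
  have hi2 : ∀ j, Integrable (fun ω => inner ℝ (I.contribution k x i j ω) (I.n k i ω)) μ :=
    fun j => integrable_inner_of_memLp_two (hc j) hn
  have hi1' := integrable_finsetSum s fun j _ => integrable_finsetSum s fun l _ => hi1 j l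
  have hi2' := (integrable_finsetSum s fun j _ => hi2 j).const_mul 2
  have hi3 : Integrable (fun ω => ‖I.n k i ω‖ ^ 2) μ := hn.integrable_norm_pow (by norm_num)
  simp_rw [hexp]
  have hi12 := hi1'.add hi2'
  simp only [Pi.add_def] at hi12
  rw [integral_add hi12 hi3, integral_add hi1' hi2', integral_const_mul,
    integral_finsetSum _ fun j _ => hi2 j, I.integral_norm_sq_n,
    integral_finsetSum _ fun j _ => integrable_finsetSum s fun l _ => hi1 j l]
  simp_rw [integral_inner_contribution_n, Finset.sum_const_zero, mul_zero, add_zero]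
  rw [add_comm]
  congr 1
  have hrow : ∀ j ∈ s, ∫ ω, ∑ l ∈ s,
      inner ℝ (I.contribution k x i j ω) (I.contribution k x i l ω) ∂μ = S.abar k i j * |x j| := by
    intro j hj
    have hadj : (S.G k).Adj i j := (Finset.mem_filter.1 hj).2
    rw [integral_finsetSum _ fun l _ => hi1 j l, Finset.sum_eq_single_of_mem j hj fun l _ hl =>
      I.integral_inner_contribution k x i hl.symm]
    simp_rw [real_inner_self_eq_norm_sq]
    rw [I.integral_norm_contribution_sq k x hadj.ne, System.abar, if_pos hadj]
  rw [Finset.sum_congr rfl hrow]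
  refine Finset.sum_subset (Finset.subset_univ _) fun j _ hj => ?_
  have hadj : ¬ (S.G k).Adj i j := by simpa [hs] using hj
  rw [System.abar, if_neg hadj, zero_mul]

end Inputs

/-! ### The mean step and the residual -/

namespace System

variable {N : ℕ} (S : System N)

lemma abar_symm (k : ℕ) (i j : Fin N) : S.abar k i j = S.abar k j i := by
  unfold abar
  rw [(S.G k).adj_comm i j, S.Λ_symm i j]
  congr 1
  ring

lemma abar_nonneg (k : ℕ) (i j : Fin N) : 0 ≤ S.abar k i j := by
  unfold abar
  split_ifs
  · have := S.ρ_pos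
    have hi := S.p_mem i
    have hj := S.p_mem j
    have h1 : 0 ≤ S.p i * (1 - S.p j) := mul_nonneg hi.1.le (by linarith [hj.2])
    have h2 : 0 ≤ S.p j * (1 - S.p i) := mul_nonneg hj.1.le (by linarith [hi.2])
    positivity
  · exact le_rfl

lemma abar_of_failed {k : ℕ} {i : Fin N} (hi : i ∈ S.failed k) (j : Fin N) :
    S.abar k i j = 0 := by
  rw [abar, if_neg (S.not_adj_of_failed k i hi j)]

/-- The conditional mean of the next state of agent `i`. -/
noncomputable def meanStep (k : ℕ) (x : Fin N → ℝ) (i : Fin N) : ℝ :=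
  (1 - S.α k * ∑ j, S.abar k i j) * x i + S.α k * ∑ j, S.abar k i j * |x j|

lemma measurable_meanStep (k : ℕ) (i : Fin N) : Measurable fun x => S.meanStep k x i := by
  unfold meanStep
  fun_prop

/-- The mean step is a convex combination of `x_i` and the `|x_j|`, so Jensen bounds its square by
the same combination of squares; summed over `i`, the exchanged terms cancel by symmetry of `ā`. -/
lemma sum_meanStep_sq_le (hw : ∀ i k, 0 < 1 - S.α k * ∑ j, S.abar k i j) (k : ℕ)
    (x : Fin N → ℝ) : ∑ i, S.meanStep k x i ^ 2 ≤ ∑ i, x i ^ 2 := by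
  have hα := S.α_pos k
  have h1 : ∀ i, S.meanStep k x i ^ 2 ≤
      x i ^ 2 + S.α k * (∑ j, S.abar k i j * x j ^ 2 - ∑ j, S.abar k i j * x i ^ 2) := by
    intro i
    set f := S.meanStep k x i with hf
    -- Jensen's inequality in the form that the weighted variance about the mean `f` is nonnegative.
    have h2 : 0 ≤ (1 - S.α k * ∑ j, S.abar k i j) * (x i - f) ^ 2
        + S.α k * ∑ j, S.abar k i j * (|x j| - f) ^ 2 :=
      add_nonneg (mul_nonneg (hw i k).le (sq_nonneg _)) (mul_nonneg hα.le
        (Finset.sum_nonneg fun j _ => mul_nonneg (S.abar_nonneg k i j) (sq_nonneg _)))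
    have h3 : ∑ j, S.abar k i j * (|x j| - f) ^ 2 = ∑ j, S.abar k i j * x j ^ 2
        - 2 * f * ∑ j, S.abar k i j * |x j| + f ^ 2 * ∑ j, S.abar k i j := by
      rw [Finset.mul_sum, Finset.mul_sum, ← Finset.sum_sub_distrib, ← Finset.sum_add_distrib]
      refine Finset.sum_congr rfl fun j _ => ?_
      rw [← sq_abs (x j)]
      ring
    have h4 : f = (1 - S.α k * ∑ j, S.abar k i j) * x i + S.α k * ∑ j, S.abar k i j * |x j| := rfl
    rw [h3] at h2
    rw [← Finset.sum_mul]
    set A := ∑ j, S.abar k i j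
    set P := ∑ j, S.abar k i j * |x j|
    set Q := ∑ j, S.abar k i j * x j ^ 2
    have h5 : f * f = f * ((1 - S.α k * A) * x i + S.α k * P) := congrArg (f * ·) h4
    linarith
  refine (Finset.sum_le_sum fun i _ => h1 i).trans_eq ?_
  rw [Finset.sum_add_distrib, ← Finset.mul_sum, Finset.sum_sub_distrib, Finset.sum_comm]
  simp_rw [S.abar_symm k]
  rw [sub_self, mul_zero, add_zero]

open Classical in
/-- The deviation of the increment of agent `i` from its conditional mean, as a function of the
states and of the inputs of agent `i`. -/
noncomputable def residual (k : ℕ) (i : Fin N)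
    (q : (Fin N → ℝ) × ((Fin N → ℝ) × (Fin N → ℂ) × ℂ)) : ℝ :=
  if i ∈ S.failed k then 0
  else ‖(∑ j with (S.G k).Adj i j,
      ((q.2.1 i * (1 - q.2.1 j) + q.2.1 j * (1 - q.2.1 i) : ℝ) : ℂ) * q.2.2.1 j
        * S.signal (q.1 j)) + q.2.2.2‖ ^ 2 - (S.σ i : ℝ) ^ 2 - ∑ j, S.abar k i j * |q.1 j|

lemma measurable_residual (k : ℕ) (i : Fin N) : Measurable (S.residual k i) := by
  unfold residual
  split_ifs
  · exact measurable_const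
  · have h := S.measurable_signal
    fun_prop

end System

/-! ### Martingale differences and the energy bound -/

namespace Inputs

variable {N : ℕ} {S : System N} {Ω : Type*} [mΩ : MeasurableSpace Ω] {μ : Measure Ω}
  (I : Inputs S μ)

/-- The martingale difference noise in the recursion of agent `i` at time `k`. -/
noncomputable def innovation (k : ℕ) (i : Fin N) (ω : Ω) : ℝ :=
  S.residual k i (I.state k ω, I.current k i ω)

lemma residual_current (k : ℕ) (i : Fin N) (hi : i ∉ S.failed k) (x : Fin N → ℝ) (ω : Ω) :
    S.residual k i (x, I.current k i ω) =
      ‖I.received k x i ω‖ ^ 2 - (S.σ i : ℝ) ^ 2 - ∑ j, S.abar k i j * |x j| :=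
  if_neg hi

/-- Failed agents need no separate treatment: their weights vanish, so the mean step fixes their
state, and their residual is zero. -/
lemma state_succ (k : ℕ) (ω : Ω) (i : Fin N) :
    I.state (k + 1) ω i = S.meanStep k (I.state k ω) i + S.α k * I.innovation k i ω := by
  rw [state, System.meanStep]
  beta_reduce
  split_ifs with hi
  · simp [innovation, System.residual, hi, S.abar_of_failed hi]
  · rw [innovation, I.residual_current k i hi]
    ring

lemma measurable_current_past (k : ℕ) (i : Fin N) :
    Measurable[I.past (k + 1)] (I.current k i) :=
  (I.measurable_current_sigma k i).mono
    (I.sigma_mono fun s (hs : time s = k) => show time s < k + 1 by omega) le_rfl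

lemma measurable_state_past (k : ℕ) : Measurable[I.past k] (I.state k) := by
  induction k with
  | zero => exact @measurable_const _ _ _ (I.past 0) S.x₀
  | succ k ih =>
    have ih' : Measurable[I.past (k + 1)] (I.state k) := ih.mono (I.past.mono k.le_succ) le_rfl
    refine @measurable_pi_lambda _ _ _ (I.past (k + 1)) _ _ fun i => ?_
    have h1 : Measurable[I.past (k + 1)] fun ω => S.meanStep k (I.state k ω) i :=
      (S.measurable_meanStep k i).comp ih'
    have h2 : Measurable[I.past (k + 1)] fun ω =>
        S.residual k i (I.state k ω, I.current k i ω) :=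
      (S.measurable_residual k i).comp (ih'.prodMk (I.measurable_current_past k i))
    simp_rw [state_succ]
    exact h1.add (h2.const_mul _)

lemma measurable_state (k : ℕ) : Measurable (I.state k) :=
  (I.measurable_state_past k).mono (I.past.le k) le_rfl

lemma measurable_state_apply (k : ℕ) (i : Fin N) : Measurable fun ω => I.state k ω i :=
  (measurable_pi_apply i).comp (I.measurable_state k)

lemma measurable_current (k : ℕ) (i : Fin N) : Measurable (I.current k i) :=
  (I.measurable_current_sigma k i).mono (I.sigma_le _) le_rfl

lemma measurable_innovation_past (k : ℕ) (i : Fin N) :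
    Measurable[I.past (k + 1)] (I.innovation k i) :=
  (S.measurable_residual k i).comp
    (((I.measurable_state_past k).mono (I.past.mono k.le_succ) le_rfl).prodMk
      (I.measurable_current_past k i))

lemma measurable_innovation (k : ℕ) (i : Fin N) : Measurable (I.innovation k i) :=
  (I.measurable_innovation_past k i).mono (I.past.le _) le_rfl

/-- The total second moment of the states. -/
noncomputable def energy (k : ℕ) : ℝ := ∑ i, ∫ ω, I.state k ω i ^ 2 ∂μ

lemma energy_nonneg (k : ℕ) : 0 ≤ I.energy k :=
  Finset.sum_nonneg fun _ _ => integral_nonneg fun _ => sq_nonneg _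

lemma integrable_norm_received_sq (k : ℕ) (x : Fin N → ℝ) (i : Fin N) :
    Integrable (fun ω => ‖I.received k x i ω‖ ^ 2) μ :=
  (I.memLp_received k x i (p := (2 : ℕ)) (by simp)).integrable_norm_pow (by norm_num)

lemma memLp_meanStep {k : ℕ} (hx : ∀ i, MemLp (fun ω => I.state k ω i) 2 μ) (i : Fin N) :
    MemLp (fun ω => S.meanStep k (I.state k ω) i) 2 μ := by
  unfold System.meanStep
  exact ((hx i).const_mul _).add
    ((memLp_finsetSum _ fun j _ => ((hx j).abs.const_mul _)).const_mul _)

variable [IsProbabilityMeasure μ]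

lemma integral_residual (k : ℕ) (i : Fin N) (x : Fin N → ℝ) :
    ∫ ω, S.residual k i (x, I.current k i ω) ∂μ = 0 := by
  by_cases hi : i ∈ S.failed k
  · simp [System.residual, hi]
  · have h := I.integrable_norm_received_sq k x i
    simp_rw [I.residual_current k i hi, sub_sub]
    rw [integral_sub h (integrable_const _), I.integral_norm_received_sq]
    simp

/-- For a working agent this is the variance of `‖y‖ ^ 2` at frozen states, which is at most the
fourth moment of `y`. -/
lemma integrable_residual_sq (k : ℕ) (i : Fin N) (x : Fin N → ℝ) :
    Integrable (fun ω => S.residual k i (x, I.current k i ω) ^ 2) μ ∧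
    ∫ ω, S.residual k i (x, I.current k i ω) ^ 2 ∂μ ≤ I.momentBound * (1 + ∑ j, x j ^ 2) := by
  have hX : 0 ≤ ∑ j, x j ^ 2 := Finset.sum_nonneg fun j _ => sq_nonneg _
  have hM := I.momentBound_nonneg
  by_cases hi : i ∈ S.failed k
  · simp only [System.residual, hi, if_true]
    refine ⟨by simp, ?_⟩
    simp only [ne_eq, OfNat.ofNat_ne_zero, not_false_eq_true, zero_pow, integral_zero]
    positivity
  · set m := (S.σ i : ℝ) ^ 2 + ∑ j, S.abar k i j * |x j| with hm
    have h2 := I.integrable_norm_received_sq k x i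
    have h4 := I.integrable_norm_received_pow_four k x i
    have heq : ∀ ω, S.residual k i (x, I.current k i ω) ^ 2 =
        ‖I.received k x i ω‖ ^ 4 - (2 * m) * ‖I.received k x i ω‖ ^ 2 + m ^ 2 := fun ω => by
      rw [I.residual_current k i hi, hm]; ring
    simp_rw [heq]
    have h24 := h4.sub (h2.const_mul (2 * m))
    simp only [Pi.sub_def] at h24
    refine ⟨h24.add (integrable_const _), ?_⟩
    rw [integral_add h24 (integrable_const _), integral_sub h4 (h2.const_mul _),
      integral_const_mul, I.integral_norm_received_sq, ← hm]
    have := I.integral_norm_received_pow_four_le k x i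
    simp only [integral_const, probReal_univ, one_smul]
    nlinarith [sq_nonneg m]

/-- Square integrability of the states is a hypothesis because `memLp_state` is proved by an
induction that uses this lemma. -/
lemma memLp_innovation {k : ℕ} (hx : ∀ i, MemLp (fun ω => I.state k ω i) 2 μ) (i : Fin N) :
    MemLp (I.innovation k i) 2 μ ∧ ∫ ω, I.innovation k i ω ^ 2 ∂μ ≤
      I.momentBound * (1 + ∑ j, ∫ ω, I.state k ω j ^ 2 ∂μ) := by
  have hint : ∀ j, Integrable (fun ω => I.state k ω j ^ 2) μ := fun j => (hx j).integrable_sq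
  have hsum := integrable_finsetSum Finset.univ fun j _ => hint j
  have h := IndepFun.integrable_and_integral_le_of_forall
    (F := fun q => S.residual k i q ^ 2) (b := fun x => I.momentBound * (1 + ∑ j, x j ^ 2))
    (I.measurable_state k) (I.measurable_current k i)
    (I.indepFun_current (I.measurable_state_past k)) ((S.measurable_residual k i).pow_const 2)
    (fun _ => sq_nonneg _) (by fun_prop)
    (((integrable_const (1 : ℝ)).add hsum).const_mul _)
    (fun x => (I.integrable_residual_sq k i x).1) (fun x => (I.integrable_residual_sq k i x).2)
  refine ⟨(memLp_two_iff_integrable_sq (I.measurable_innovation k i).aestronglyMeasurable).2 h.1,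
    h.2.trans_eq ?_⟩
  rw [integral_const_mul, integral_add (integrable_const _) hsum,
    integral_finsetSum _ fun j _ => hint j]
  simp

/-- The martingale difference property in `L²` form: `φ` is frozen together with the state, and the
residual then has mean zero. -/
lemma integral_mul_innovation {k : ℕ} (hx : ∀ i, MemLp (fun ω => I.state k ω i) 2 μ) (i : Fin N)
    {φ : Ω → ℝ} (hφ : Measurable[I.past k] φ) (hφ2 : MemLp φ 2 μ) :
    ∫ ω, φ ω * I.innovation k i ω ∂μ = 0 := by
  have hZ : Measurable[I.past k] fun ω => (φ ω, I.state k ω) :=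
    hφ.prodMk (I.measurable_state_past k)
  refine IndepFun.integral_eq_zero_of_forall (Z := fun ω => (φ ω, I.state k ω))
    (F := fun q => q.1.1 * S.residual k i (q.1.2, q.2))
    (hZ.mono (I.past.le k) le_rfl) (I.measurable_current k i) (I.indepFun_current hZ) ?_
    (hφ2.integrable_mul (I.memLp_innovation hx i).1) fun z => ?_
  · have := S.measurable_residual k i
    fun_prop
  · change ∫ ω, z.1 * S.residual k i (z.2, I.current k i ω) ∂μ = 0
    rw [integral_const_mul, I.integral_residual, mul_zero]

lemma memLp_state (k : ℕ) (i : Fin N) : MemLp (fun ω => I.state k ω i) 2 μ := by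
  induction k generalizing i with
  | zero => exact memLp_const (S.x₀ i)
  | succ k ih =>
    simp_rw [state_succ]
    exact (I.memLp_meanStep ih i).add ((I.memLp_innovation ih i).1.const_mul _)

lemma integral_state_succ_sq (k : ℕ) (i : Fin N) :
    ∫ ω, I.state (k + 1) ω i ^ 2 ∂μ = ∫ ω, S.meanStep k (I.state k ω) i ^ 2 ∂μ
      + S.α k ^ 2 * ∫ ω, I.innovation k i ω ^ 2 ∂μ := by
  have hx := I.memLp_state k
  have hm := I.memLp_meanStep hx i
  have hξ := (I.memLp_innovation hx i).1
  have h0 := I.integral_mul_innovation hx i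
    ((S.measurable_meanStep k i).comp (I.measurable_state_past k)) hm
  have heq : ∀ ω, I.state (k + 1) ω i ^ 2 = S.meanStep k (I.state k ω) i ^ 2
      + 2 * S.α k * (S.meanStep k (I.state k ω) i * I.innovation k i ω)
      + S.α k ^ 2 * I.innovation k i ω ^ 2 := fun ω => by rw [state_succ]; ring
  simp_rw [heq]
  have h1 := hm.integrable_sq
  have h2 := (hm.integrable_mul hξ).const_mul (2 * S.α k)
  have h3 := hξ.integrable_sq.const_mul (S.α k ^ 2)
  have h12 := h1.add h2
  simp only [Pi.add_def, Pi.mul_apply] at h2 h12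
  simp only [Function.comp_def] at h0
  rw [integral_add h12 h3, integral_add h1 h2, integral_const_mul, integral_const_mul, h0]
  ring

lemma integral_innovation_sq_le (k : ℕ) (i : Fin N) :
    ∫ ω, I.innovation k i ω ^ 2 ∂μ ≤ I.momentBound * (1 + I.energy k) :=
  (I.memLp_innovation (I.memLp_state k) i).2

lemma energy_succ_le (hw : ∀ i k, 0 < 1 - S.α k * ∑ j, S.abar k i j) (k : ℕ) :
    I.energy (k + 1) ≤ I.energy k + S.α k ^ 2 * (N * (I.momentBound * (1 + I.energy k))) := by
  have hx := I.memLp_state k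
  unfold energy
  simp_rw [integral_state_succ_sq]
  rw [Finset.sum_add_distrib, ← Finset.mul_sum]
  refine add_le_add ?_ (mul_le_mul_of_nonneg_left ?_ (sq_nonneg _))
  · rw [← integral_finsetSum _ fun i _ => (I.memLp_meanStep hx i).integrable_sq,
      ← integral_finsetSum _ fun i _ => (hx i).integrable_sq]
    exact integral_mono
      (integrable_finsetSum _ fun i _ => (I.memLp_meanStep hx i).integrable_sq)
      (integrable_finsetSum _ fun i _ => (hx i).integrable_sq)
      fun ω => S.sum_meanStep_sq_le hw k (I.state k ω)
  · refine (Finset.sum_le_sum fun i _ => I.integral_innovation_sq_le k i).trans_eq ?_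
    simp [energy]

/-- Discrete Grönwall: `1 + energy` grows at step `k` by a factor at most `1 + C α(k)² ≤ exp (C
α(k)²)`. -/
lemma exists_energy_le (hstep : S.StepSize) : ∃ V, ∀ k, I.energy k ≤ V := by
  set C := N * I.momentBound
  have hC : 0 ≤ C := mul_nonneg (Nat.cast_nonneg _) I.momentBound_nonneg
  have h1 : ∀ k, 1 + I.energy k ≤
      (1 + I.energy 0) * Real.exp (∑ l ∈ Finset.range k, C * S.α l ^ 2) := by
    intro k
    induction k with
    | zero => simp
    | succ k ih =>
      rw [Finset.sum_range_succ, Real.exp_add, ← mul_assoc]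
      have h2 := I.energy_succ_le hstep.weight_pos k
      have h3 : 1 + I.energy (k + 1) ≤ (1 + I.energy k) * (C * S.α k ^ 2 + 1) := by
        simp only [C]; linarith
      have h4 := Real.add_one_le_exp (C * S.α k ^ 2)
      have h5 := I.energy_nonneg k
      exact h3.trans (mul_le_mul ih h4 (by positivity) (by linarith))
  refine ⟨(1 + I.energy 0) * Real.exp (∑' l, C * S.α l ^ 2), fun k => ?_⟩
  have h2 : ∑ l ∈ Finset.range k, C * S.α l ^ 2 ≤ ∑' l, C * S.α l ^ 2 :=
    (hstep.summable_sq.mul_left C).sum_le_tsum _ fun l _ => by positivity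
  have h3 := I.energy_nonneg 0
  have h4 := (h1 k).trans (mul_le_mul_of_nonneg_left (Real.exp_le_exp.2 h2) (by linarith))
  linarith

end Inputs

/-- By Tonelli the sum has finite expectation, hence is finite almost everywhere. -/
lemma ae_summable_of_sum_integral_le {Ω : Type*} [MeasurableSpace Ω] {μ : Measure Ω}
    {f : ℕ → Ω → ℝ} (hf : ∀ n, Integrable (f n) μ) (hf0 : ∀ n ω, 0 ≤ f n ω) {C : ℝ}
    (hC : ∀ n, ∑ k ∈ Finset.range n, ∫ ω, f k ω ∂μ ≤ C) :
    ∀ᵐ ω ∂μ, Summable fun n => f n ω := by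
  have hsum : Summable fun n => ∫ ω, f n ω ∂μ :=
    summable_of_sum_range_le (fun n => integral_nonneg (hf0 n)) hC
  have hmeas : ∀ n, AEMeasurable (fun ω => ENNReal.ofReal (f n ω)) μ := fun n =>
    (hf n).aemeasurable.ennreal_ofReal
  have hfin : ∫⁻ ω, ∑' n, ENNReal.ofReal (f n ω) ∂μ ≠ ⊤ := by
    rw [lintegral_tsum hmeas]
    simp_rw [← ofReal_integral_eq_lintegral_ofReal (hf _) (ae_of_all _ (hf0 _))]
    rw [← ENNReal.ofReal_tsum_of_nonneg (fun n => integral_nonneg (hf0 n)) hsum]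
    exact ENNReal.ofReal_ne_top
  filter_upwards [ae_lt_top' (AEMeasurable.tsum hmeas) hfin] with ω hω
  refine (ENNReal.summable_toReal hω.ne).congr fun n => ?_
  exact ENNReal.toReal_ofReal (hf0 n ω)

/-! ### Weight bounds and the sign drift -/

namespace System

variable {N : ℕ} (S : System N)

lemma exists_abar_bounds : ∃ b m : ℝ, 0 < m ∧ (∀ k i j, S.abar k i j ≤ b) ∧
    ∀ k i j, (S.G k).Adj i j → m ≤ S.abar k i j := by
  set W : Fin N → Fin N → ℝ := fun i j =>
    S.ρ * (S.p i * (1 - S.p j) + S.p j * (1 - S.p i)) * (S.Λ i j : ℝ) with hW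
  have hq : ∀ i j, 0 < S.p i * (1 - S.p j) + S.p j * (1 - S.p i) := fun i j =>
    add_pos (mul_pos (S.p_mem i).1 (by linarith [(S.p_mem j).2]))
      (mul_pos (S.p_mem j).1 (by linarith [(S.p_mem i).2]))
  have hW0 : ∀ i j, 0 ≤ W i j := fun i j =>
    mul_nonneg (mul_pos S.ρ_pos (hq i j)).le (NNReal.coe_nonneg _)
  -- The weights depend on time only through adjacency, so finitely many positive values occur and
  -- every small `m > 0` lies below them all; with no edges the condition is vacuous.
  have hev : ∀ᶠ m in 𝓝[>] (0 : ℝ), ∀ i j, 0 < W i j → m ≤ W i j := by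
    simp_rw [eventually_all]
    exact fun i j hij => nhdsWithin_le_nhds (eventually_le_nhds hij)
  obtain ⟨m, hm, hm0⟩ := (hev.and self_mem_nhdsWithin).exists
  refine ⟨∑ i, ∑ j, W i j, m, hm0, fun k i j => ?_, fun k i j hij => ?_⟩
  · have h1 : W i j ≤ ∑ i, ∑ j, W i j :=
      (Finset.single_le_sum (f := fun j => W i j) (fun j _ => hW0 i j) (Finset.mem_univ j)).trans
      (Finset.single_le_sum (f := fun i => ∑ j, W i j)
        (fun i _ => Finset.sum_nonneg fun j _ => hW0 i j) (Finset.mem_univ i))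
    rw [abar]
    split_ifs
    · exact h1
    · exact (hW0 i j).trans h1
  · rw [abar, if_pos hij]
    exact hm i j (mul_pos (mul_pos S.ρ_pos (hq i j)) (by exact_mod_cast S.Λ_pos k i j hij))

/-- The drift of agent `i` caused by the loss of the sign of negative states. -/
noncomputable def signDrift (k : ℕ) (x : Fin N → ℝ) (i : Fin N) : ℝ :=
  S.α k * ∑ j, S.abar k i j * (|x j| - x j)

lemma signDrift_nonneg (k : ℕ) (x : Fin N → ℝ) (i : Fin N) : 0 ≤ S.signDrift k x i :=
  mul_nonneg (S.α_pos k).le (Finset.sum_nonneg fun j _ =>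
    mul_nonneg (S.abar_nonneg k i j) (sub_nonneg.2 (le_abs_self _)))

lemma meanStep_eq (k : ℕ) (x : Fin N → ℝ) (i : Fin N) : S.meanStep k x i =
    x i - S.α k * ∑ j, S.abar k i j * (x i - x j) + S.signDrift k x i := by
  simp only [meanStep, signDrift, mul_sub, Finset.sum_sub_distrib, ← Finset.sum_mul]
  ring

lemma sum_meanStep (k : ℕ) (x : Fin N → ℝ) :
    ∑ i, S.meanStep k x i = ∑ i, x i + ∑ i, S.signDrift k x i := by
  have h := sum_laplacian (S.abar_symm k) (WithLp.toLp 2 x)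
  simp only [laplacian_apply] at h
  simp_rw [meanStep_eq]
  rw [Finset.sum_add_distrib, Finset.sum_sub_distrib, ← Finset.mul_sum, h, mul_zero, sub_zero]

end System

/-! ### Convergence of the noise and drift series -/

namespace Inputs

variable {N : ℕ} {S : System N} {Ω : Type*} [mΩ : MeasurableSpace Ω] {μ : Measure Ω}
  (I : Inputs S μ) [IsProbabilityMeasure μ]

/-- The accumulated noise of agent `i`. -/
noncomputable def noiseSum (i : Fin N) (n : ℕ) (ω : Ω) : ℝ :=
  ∑ k ∈ Finset.range n, S.α k * I.innovation k i ω

omit [IsProbabilityMeasure μ] in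
lemma noiseSum_succ (i : Fin N) (n : ℕ) (ω : Ω) :
    I.noiseSum i (n + 1) ω = I.noiseSum i n ω + S.α n * I.innovation n i ω :=
  Finset.sum_range_succ _ _

omit [IsProbabilityMeasure μ] in
lemma measurable_noiseSum (i : Fin N) (n : ℕ) : Measurable[I.past n] (I.noiseSum i n) := by
  refine Finset.measurable_fun_sum _ fun k hk => ?_
  exact ((I.measurable_innovation_past k i).mono
    (I.past.mono (Finset.mem_range.1 hk)) le_rfl).const_mul _

lemma memLp_noiseSum (i : Fin N) (n : ℕ) : MemLp (I.noiseSum i n) 2 μ :=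
  memLp_finsetSum _ fun k _ => (I.memLp_innovation (I.memLp_state k) i).1.const_mul _

lemma integral_noiseSum_sq_succ (i : Fin N) (n : ℕ) :
    ∫ ω, I.noiseSum i (n + 1) ω ^ 2 ∂μ =
      ∫ ω, I.noiseSum i n ω ^ 2 ∂μ + S.α n ^ 2 * ∫ ω, I.innovation n i ω ^ 2 ∂μ := by
  have hx := I.memLp_state n
  have hm := I.memLp_noiseSum i n
  have hξ := (I.memLp_innovation hx i).1
  have h0 := I.integral_mul_innovation hx i (I.measurable_noiseSum i n) hm
  have heq : ∀ ω, I.noiseSum i (n + 1) ω ^ 2 = I.noiseSum i n ω ^ 2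
      + 2 * S.α n * (I.noiseSum i n ω * I.innovation n i ω)
      + S.α n ^ 2 * I.innovation n i ω ^ 2 := fun ω => by rw [noiseSum_succ]; ring
  simp_rw [heq]
  have h1 := hm.integrable_sq
  have h2 := (hm.integrable_mul hξ).const_mul (2 * S.α n)
  have h3 := hξ.integrable_sq.const_mul (S.α n ^ 2)
  have h12 := h1.add h2
  simp only [Pi.add_def, Pi.mul_apply] at h2 h12
  rw [integral_add h12 h3, integral_add h1 h2, integral_const_mul, integral_const_mul, h0]
  ring

lemma martingale_noiseSum (i : Fin N) : Martingale (I.noiseSum i) I.past μ := by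
  have hint : ∀ n, Integrable (I.noiseSum i n) μ := fun n =>
    (I.memLp_noiseSum i n).integrable (by norm_num)
  refine martingale_of_setIntegral_eq_succ
    (fun n => (I.measurable_noiseSum i n).stronglyMeasurable) hint fun n s hs => ?_
  have hx := I.memLp_state n
  have hξ : Integrable (I.innovation n i) μ := (I.memLp_innovation hx i).1.integrable (by norm_num)
  have hs' := I.past.le n s hs
  have h0 : ∫ ω in s, I.innovation n i ω ∂μ = 0 := by
    -- Orthogonality to the past, tested on the indicator of `s`, is the martingale property.
    rw [← integral_indicator hs', ← I.integral_mul_innovation hx i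
      (φ := s.indicator fun _ => 1) (measurable_const.indicator hs)
      (memLp_indicator_const 2 hs' 1 (Or.inr (measure_ne_top _ _)))]
    refine integral_congr_ae (ae_of_all _ fun ω => ?_)
    by_cases hω : ω ∈ s <;> simp [hω]
  simp_rw [noiseSum_succ]
  rw [integral_add (hint n).integrableOn (hξ.const_mul _).integrableOn, integral_const_mul, h0]
  simp

/-- Orthogonal increments give second moments at most `∑ α² B`. With `|t| ≤ 1 + t²` the martingale
is bounded in `L¹`, and Doob's theorem applies. -/
lemma ae_tendsto_noiseSum (hstep : S.StepSize) (i : Fin N) :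
    ∀ᵐ ω ∂μ, ∃ D, Tendsto (fun n => I.noiseSum i n ω) atTop (𝓝 D) := by
  obtain ⟨V, hV⟩ := I.exists_energy_le hstep
  set B := I.momentBound * (1 + V)
  have hB : ∀ k, ∫ ω, I.innovation k i ω ^ 2 ∂μ ≤ B := fun k =>
    (I.integral_innovation_sq_le k i).trans
      (mul_le_mul_of_nonneg_left (by linarith [hV k]) I.momentBound_nonneg)
  have hB0 : 0 ≤ B := (integral_nonneg fun _ => sq_nonneg _).trans (hB 0)
  have h1 : ∀ n, ∫ ω, I.noiseSum i n ω ^ 2 ∂μ ≤ ∑ k ∈ Finset.range n, S.α k ^ 2 * B := by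
    intro n
    induction n with
    | zero => simp [noiseSum]
    | succ n ih =>
      rw [I.integral_noiseSum_sq_succ, Finset.sum_range_succ]
      exact add_le_add ih (mul_le_mul_of_nonneg_left (hB n) (sq_nonneg _))
  have h2 : ∀ n, ∫ ω, I.noiseSum i n ω ^ 2 ∂μ ≤ ∑' k, S.α k ^ 2 * B := fun n =>
    (h1 n).trans ((hstep.summable_sq.mul_right B).sum_le_tsum _ fun k _ => by positivity)
  set R : ℝ≥0 := (1 + ∑' k, S.α k ^ 2 * B).toNNReal
  have h3 : ∀ n, eLpNorm (I.noiseSum i n) 1 μ ≤ R := by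
    intro n
    have hsq := (I.memLp_noiseSum i n).integrable_sq
    have hint : Integrable (I.noiseSum i n) μ := (I.memLp_noiseSum i n).integrable (by norm_num)
    rw [eLpNorm_one_eq_lintegral_enorm, ← ofReal_integral_norm_eq_lintegral_enorm hint]
    refine ENNReal.ofReal_le_ofReal ?_
    calc ∫ ω, ‖I.noiseSum i n ω‖ ∂μ ≤ ∫ ω, (1 + I.noiseSum i n ω ^ 2) ∂μ := by
          refine integral_mono hint.norm ((integrable_const _).add hsq) fun ω => ?_
          have := sq_nonneg (|I.noiseSum i n ω| - 1)
          simp only [Real.norm_eq_abs]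
          nlinarith [sq_abs (I.noiseSum i n ω), abs_nonneg (I.noiseSum i n ω)]
      _ = 1 + ∫ ω, I.noiseSum i n ω ^ 2 ∂μ := by
          rw [integral_add (integrable_const _) hsq]; simp
      _ ≤ _ := by linarith [h2 n]
  exact (I.martingale_noiseSum i).submartingale.exists_ae_tendsto_of_bdd h3

lemma integral_innovation (k : ℕ) (i : Fin N) : ∫ ω, I.innovation k i ω ∂μ = 0 := by
  simpa using I.integral_mul_innovation (I.memLp_state k) i (φ := fun _ => 1) measurable_const
    (memLp_const 1)

lemma integrable_signDrift (k : ℕ) (i : Fin N) :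
    Integrable (fun ω => S.signDrift k (I.state k ω) i) μ := by
  have h : ∀ j, Integrable (fun ω => I.state k ω j) μ := fun j =>
    (I.memLp_state k j).integrable (by norm_num)
  exact (integrable_finsetSum _ fun j _ => ((h j).abs.sub (h j)).const_mul _).const_mul _

/-- In the expected sum of the states only the drift survives, so the expected drifts telescope; by
`t ≤ 1 + t²` and the energy bound that expectation never exceeds `N + V`. -/
lemma ae_summable_signDrift (hstep : S.StepSize) :
    ∀ᵐ ω ∂μ, Summable fun k => ∑ i, S.signDrift k (I.state k ω) i := by
  obtain ⟨V, hV⟩ := I.exists_energy_le hstep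
  have hx : ∀ k i, Integrable (fun ω => I.state k ω i) μ := fun k i =>
    (I.memLp_state k i).integrable (by norm_num)
  have hb : ∀ k, Integrable (fun ω => ∑ i, S.signDrift k (I.state k ω) i) μ := fun k =>
    integrable_finsetSum _ fun i _ => I.integrable_signDrift k i
  have hξ : ∀ k i, Integrable (fun ω => S.α k * I.innovation k i ω) μ := fun k i =>
    ((I.memLp_innovation (I.memLp_state k) i).1.integrable (by norm_num)).const_mul _
  have hstepE : ∀ k, ∫ ω, ∑ i, I.state (k + 1) ω i ∂μ =
      ∫ ω, ∑ i, I.state k ω i ∂μ + ∫ ω, ∑ i, S.signDrift k (I.state k ω) i ∂μ := by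
    intro k
    have hsx := integrable_finsetSum Finset.univ fun i _ => hx k i
    have hsξ := integrable_finsetSum Finset.univ fun i _ => hξ k i
    simp_rw [state_succ, Finset.sum_add_distrib, S.sum_meanStep]
    have h12 := hsx.add (hb k)
    simp only [Pi.add_def] at h12
    rw [integral_add h12 hsξ, integral_add hsx (hb k), integral_finsetSum _ fun i _ => hξ k i]
    simp [integral_const_mul, I.integral_innovation]
  have hsum : ∀ n, ∑ k ∈ Finset.range n, ∫ ω, ∑ i, S.signDrift k (I.state k ω) i ∂μ =
      ∫ ω, ∑ i, I.state n ω i ∂μ - ∫ ω, ∑ i, I.state 0 ω i ∂μ := by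
    intro n
    rw [← Finset.sum_range_sub fun k => ∫ ω, ∑ i, I.state k ω i ∂μ]
    exact Finset.sum_congr rfl fun k _ => by rw [hstepE]; ring
  have hle : ∀ n, ∫ ω, ∑ i, I.state n ω i ∂μ ≤ N + V := by
    intro n
    have hsq : ∀ i, Integrable (fun ω => I.state n ω i ^ 2) μ := fun i =>
      (I.memLp_state n i).integrable_sq
    rw [integral_finsetSum _ fun i _ => hx n i]
    calc ∑ i, ∫ ω, I.state n ω i ∂μ ≤ ∑ i, (1 + ∫ ω, I.state n ω i ^ 2 ∂μ) := by
          refine Finset.sum_le_sum fun i _ => ?_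
          have h1 : ∫ ω, I.state n ω i ∂μ ≤ ∫ ω, (1 + I.state n ω i ^ 2) ∂μ :=
            integral_mono (hx n i) ((integrable_const _).add (hsq i)) fun ω => by
              nlinarith [sq_nonneg (I.state n ω i - 1), sq_nonneg (I.state n ω i)]
          rw [integral_add (integrable_const _) (hsq i)] at h1
          simpa using h1
      _ = N + I.energy n := by simp [Finset.sum_add_distrib, energy]
      _ ≤ N + V := by linarith [hV n]
  exact ae_summable_of_sum_integral_le hb
    (fun k ω => Finset.sum_nonneg fun i _ => S.signDrift_nonneg k _ i)
    (C := N + V - ∫ ω, ∑ i, I.state 0 ω i ∂μ) fun n => by rw [hsum]; linarith [hle n]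

theorem ae_exists_tendsto_state (hstep : S.StepSize) (hconn : S.JointlyConnected)
    (hreg : S.StepSizeRegular) :
    ∀ᵐ ω ∂μ, ∃ c, ∀ i, Tendsto (fun k => I.state k ω i) atTop (𝓝 c) := by
  obtain ⟨b, m, hm, hb, hadj⟩ := S.exists_abar_bounds
  obtain ⟨L, hL, hconn⟩ := hconn
  have hα0 : Tendsto S.α atTop (𝓝 0) := by
    have := hstep.summable_sq.tendsto_atTop_zero.sqrt
    simpa [Real.sqrt_sq (S.α_pos _).le] using this
  filter_upwards [ae_all_iff.2 fun i => I.ae_tendsto_noiseSum hstep i,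
    I.ae_summable_signDrift hstep] with ω hM hs
  choose D hD using hM
  have hsi : ∀ i, Summable fun k => S.signDrift k (I.state k ω) i := fun i =>
    hs.of_nonneg_of_le (fun k => S.signDrift_nonneg k _ i) fun k =>
      Finset.single_le_sum (f := fun i => S.signDrift k (I.state k ω) i)
        (fun i _ => S.signDrift_nonneg k _ i) (Finset.mem_univ i)
  refine exists_tendsto_of_jointlyConnected (G := S.G) (w := S.abar) S.abar_symm S.abar_nonneg hb hm
    hadj hL hconn S.α_pos (antitone_nat_of_succ_le hreg.le_succ) hα0 hstep.sum_eq_top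
    hreg.limsup_lt_top
    (d := fun k i => S.α k * I.innovation k i ω + S.signDrift k (I.state k ω) i)
    (D := fun i => D i + ∑' k, S.signDrift k (I.state k ω) i) (fun k i => ?_) fun i => ?_
  · rw [state_succ, S.meanStep_eq]
    ring
  · simp_rw [Finset.sum_add_distrib]
    exact (hD i).add (hsi i).hasSum.tendsto_sum_nat

end Inputs

end OverTheAir

theorem mainTheorem9 {N : ℕ} (S : OverTheAir.System N)
    {Ω : Type*} [MeasurableSpace Ω] (μ : Measure Ω) [IsProbabilityMeasure μ]
    (I : OverTheAir.Inputs S μ)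
    (hstep : S.StepSize) (hconn : S.JointlyConnected) (hreg : S.StepSizeRegular) :
    I.AlmostSureConsensus := by
  have h := I.ae_exists_tendsto_state hstep hconn hreg
  obtain ⟨L, -, hL⟩ := hconn
  obtain ⟨i₀⟩ := (hL 0).nonempty
  -- The pathwise limits come without measurability in `ω`. A measurable version is taken along one
  -- agent, and uniqueness of limits identifies it for the others.
  obtain ⟨xstar, hmeas, hlim⟩ := measurable_limit_of_tendsto_metrizable_ae
    (fun k => (I.measurable_state_apply k i₀).aemeasurable) (h.mono fun ω ⟨c, hc⟩ => ⟨c, hc i₀⟩)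
  refine ⟨xstar, hmeas, fun i => ?_⟩
  filter_upwards [h, hlim] with ω ⟨c, hc⟩ hω
  rw [← tendsto_nhds_unique (hc i₀) hω]
  exact hc i
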